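/- Let $(X_n)_{n\ge 0}$ be the canonical process on $\mathbb{Z}^{\mathbb{N}_0}$, $\mathcal F_n=\sigma(X_0,\dots,X_n)$, $\mathcal F_\infty=\sigma(X_n,n\ge0)$, and let $\mathbb{P}_x$ be the law of the simple random walk on $\mathbb{Z}$ started at $x$, i.e. of the Markov chain with $p_{x,x+1}=p_{x,x-1}=1/2$. *Definitions* (with reference point $0$). Let $T'=\inf\{n\ge1: X_n=0\}$, $$G_0(x,y)=\mathbb{E}_x\Big[\sum_{n<T'}\mathbf 1_{X_n=y}\Big],\qquad L_0(x,y)=\frac{G_0(x,y)}{G_0(0,y)},\qquad D_0(z)=\sup_{y\in\mathbb{Z}}L_0(z,y).$$ For a summable family $w=(w_z)_{z\in\mathbb{Z}}$ of strictly positive numbers, the Martin compactification is the completion of $\mathbb{Z}$ for the distance $$\delta_{0,w}(x,y)=\sum_{z\in\mathbb{Z}}w_z\,\frac{|L_0(z,x)-L_0(z,y)|+|\mathbf 1_{z=x}-\mathbf 1_{z=y}|}{D_0(z)+1};$$ the Martin boundary $\partial\mathbb{Z}$ is the complement of $\mathbb{Z}$ in it, and $L_0(x,\cdot)$ is extended to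 it by continuity. The minimal boundary $\partial_m\mathbb{Z}$ is the set of $\alpha\in\partial\mathbb{Z}$ such that $h=L_0(\cdot,\alpha)$ is minimal harmonic for the transitions $p_{x,y}\mathbf 1_{y\neq0}$, i.e. $h$ is harmonic for them and every harmonic $\psi$ with $0\le\psi\le h$ is of the form $ch$, $c\in[0,1]$. For $\alpha\in\partial\mathbb{Z}$ put $\varphi_{0,\alpha}(x)=L_0(x,\alpha)\mathbf 1_{x\ne0}$ (this corresponds to the stationary measure of the walk normalized as $\beta\equiv1$). For $\varphi\ge0$ with $\varphi(0)=0$ and $\varphi$ harmonic at all $x\ne0$, $\mathbb{Q}_x^{0,\varphi}$ denotes the $\sigma$-finite measure on $(\mathbb{Z}^{\mathbb{N}_0},\mathcal F_\infty)$ such that: $X_0=x$ almost everywhere; for every $y$, almost every trajectory visits $y$ finitely often; and $\mathbb{Q}_x^{0,\varphi}(F_n\mathbf 1_{\forall k\ge n,\,X_k\ne0})=\mathbb{E}_x[F_n\varphi(X_n)]$ for all $n\ge0$ and all nonnegative $\mathcal F_n$-measurable $F_n$. Set $\mathbb{Q}_x^\alpha=\mathbb{Q}_x^{0,\varphi_{0,\alpha}}$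 for $\alpha\in\partial_m\mathbb{Z}$. Finally, a family $(\mathbb{Q}_x)_{x\in\mathbb{Z}}$ of $\sigma$-finite measures is in the class $\mathcal{Q}$ if for all $x,y,x_0,x_1\in\mathbb{Z}$ and $n\ge0$: (1) $\mathbf 1_{X_n=y}\cdot\mathbb{Q}_x=\mathbf 1_{X_n=y}\cdot(\mathbb{P}_x^{(n)}\circ\mathbb{Q}_y)$, where $\mathbb{P}_x^{(n)}\circ\mathbb{Q}_y$ is the image of $\mathbb{P}_x\otimes\mathbb{Q}_y$ by $(\omega,\omega')\mapsto(\omega_0,\dots,\omega_n,\omega'_1,\omega'_2,\dots)$; (2) $\mathbb{Q}_x(\forall k\ge0,\ X_k\neq x_0)<\infty$; (3) $\mathbb{Q}_{x_1}(X_k=x_0\text{ for infinitely many }k)=0$. **Statement.** (a) $G_0(0,y)=L_0(0,y)=1$ for all $y\in\mathbb{Z}$, and $G_0(x,y)=L_0(x,y)=2(|x|\wedge|y|)\mathbf 1_{xy>0}$ for all $x\ne0$ and $y\in\mathbb{Z}$. The measure $\beta\equiv1$ is stationary. For every summable family $w$ of strictly positive numbers: (b) The Martin boundary is equal to the minimal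 boundary and consists of exactly two points $\infty$ and $-\infty$, distinguished by $L_0(x,\pm\infty)=2x_\pm+\mathbf 1_{x=0}$ for all $x\in\mathbb{Z}$, where $x_+=\max(x,0)$ and $x_-=\max(-x,0)$. A sequence of points of $\mathbb{Z}$ tends to $\infty$ (resp. $-\infty$) in the Martin compactification if and only if it tends to $\infty$ (resp. $-\infty$) in the usual sense. (c) $\varphi_{0,\pm\infty}(x)=2x_\pm$ for all $x\in\mathbb{Z}$, and the functions $\varphi\ge0$ on $\mathbb{Z}$ such that $\varphi(0)=0$ and $\varphi$ is harmonic at all $x\neq0$ are exactly the linear combinations of $\varphi_{0,\infty}$ and $\varphi_{0,-\infty}$ with nonnegative coefficients. (d) For each $x\in\mathbb{Z}$, the measures $\mathbb{Q}_x^{\infty}$ and $\mathbb{Q}_x^{-\infty}$ exist and are uniquely determined by the properties above, and the families in the class $\mathcal{Q}$ are exactly the families $(a\,\mathbb{Q}_x^{\infty}+b\,\mathbb{Q}_x^{-\infty})_{x\in\mathbb{Z}}$ with $a,b\ge0$. -/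

import Mathlib

open MeasureTheory ProbabilityTheory Filter Topology
open scoped ENNReal NNReal

namespace RecMartin

noncomputable section

/-! ### Markov chains on a countable set -/

section Chain

variable {E : Type*} [Countable E] [MeasurableSpace E] [MeasurableSingletonClass E]

/-- The kernel giving the law of `X (n + 1)` knowing `X 0, …, X n`. It only depends on `X n`. -/
def stepKernel (p : E → PMF E) (n : ℕ) : Kernel (Π _ : Finset.Iic n, E) E :=
  (Kernel.ofFunOfCountable fun x => (p x).toMeasure).comap
    (fun h => h ⟨n, Finset.mem_Iic.2 le_rfl⟩) (measurable_pi_apply _)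

instance (p : E → PMF E) (n : ℕ) : IsMarkovKernel (stepKernel p n) :=
  ⟨fun h => inferInstanceAs
    (IsProbabilityMeasure ((p (h ⟨n, Finset.mem_Iic.2 le_rfl⟩)).toMeasure))⟩

/-- The law `ℙ_x`, on the space of trajectories `E^ℕ` with the product `σ`-algebra, of the Markov
chain with transition probabilities `p` started at `x`. -/
def chainLaw (p : E → PMF E) (x : E) : Measure (ℕ → E) :=
  Kernel.traj (X := fun _ => E) (stepKernel p) 0 (fun _ => x)

instance (p : E → PMF E) (x : E) : IsProbabilityMeasure (chainLaw p x) :=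
  inferInstanceAs (IsProbabilityMeasure
    (Kernel.traj (X := fun _ => E) (stepKernel p) 0 (fun _ => x)))

open Classical in
/-- The finite-dimensional marginals of `ℙ_x` are those of the Markov chain. -/
theorem chainLaw_cylinder (p : E → PMF E) (x : E) (s : ℕ → E) (k : ℕ) :
    chainLaw p x {ω | ∀ i ≤ k, ω i = s i} =
      (if s 0 = x then 1 else 0) * ∏ i ∈ Finset.range k, p (s i) (s (i + 1)) := by
  have key : ∀ n, {ω : ℕ → E | ∀ i ≤ n, ω i = s i} =
      Preorder.frestrictLe (π := fun _ => E) n ⁻¹' ({fun i => s i.1} : Set (Π _ : Finset.Iic n, E)) := by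
    intro n; ext ω
    simp only [Set.mem_ofPred_eq, Set.mem_preimage, Set.mem_singleton_iff, funext_iff,
      Preorder.frestrictLe_apply, Subtype.forall, Finset.mem_Iic]
  induction k with
  | zero =>
    rw [key, ← Measure.map_apply (by fun_prop) (MeasurableSet.singleton _), chainLaw,
      Kernel.traj_map_frestrictLe_apply, Kernel.partialTraj_self, Kernel.id_apply,
      Measure.dirac_apply' _ (MeasurableSet.singleton _)]
    simp [Set.indicator, funext_iff, eq_comm]
  | succ k ih =>
    have h1 : {ω : ℕ → E | ∀ i ≤ k + 1, ω i = s i} =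
        (fun ω : ℕ → E => (Preorder.frestrictLe (π := fun _ => E) k ω, ω (k + 1))) ⁻¹'
          (({fun i => s i.1} : Set (Π _ : Finset.Iic k, E)) ×ˢ {s (k + 1)}) := by
      ext ω
      have := Set.ext_iff.1 (key k) ω
      simp only [Set.mem_ofPred_eq, Set.mem_preimage, Set.mem_singleton_iff, Set.mem_prod]
        at this ⊢
      rw [← this]
      refine ⟨fun h => ⟨fun i hi => h i (by omega), h _ le_rfl⟩, fun h i hi => ?_⟩
      rcases Nat.lt_or_ge k i with hk | hk
      · obtain rfl : i = k + 1 := by omega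
        exact h.2
      · exact h.1 i hk
    have hm : MeasurableSet ({fun i => s i.1} : Set (Π _ : Finset.Iic k, E)) :=
      MeasurableSet.singleton _
    rw [Finset.prod_range_succ, ← mul_assoc, ← ih, h1,
      ← Measure.map_apply (by fun_prop) (hm.prod (MeasurableSet.singleton _)), chainLaw,
      ← Kernel.partialTraj_compProd_eq_map_traj (Nat.zero_le k),
      Measure.compProd_apply_prod hm (MeasurableSet.singleton _),
      ← Kernel.traj_map_frestrictLe_apply]
    rw [lintegral_singleton, Measure.map_apply (by fun_prop) hm, ← key, mul_comm]
    congr 1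
    change (p (s k)).toMeasure {s (k + 1)} = _
    exact PMF.toMeasure_apply_singleton _ _ (MeasurableSet.singleton _)

/-- `β` is a (strictly positive) stationary measure of the chain. -/
def IsStationary (p : E → PMF E) (β : E → ℝ) : Prop :=
  (∀ x, 0 < β x) ∧ ∀ y, HasSum (fun x => (p x y).toReal * β x) (β y)

/-- `φ` is harmonic for `p` at every point except possibly at `x₀`. -/
def HarmonicOff (p : E → PMF E) (x₀ : E) (φ : E → ℝ) : Prop :=
  ∀ x, x ≠ x₀ → HasSum (fun y => (p x y).toReal * φ y) (φ x)

/-! ### The `σ`-finite measures `ℚ_x^{x₀, φ}` and the class `𝒬` -/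

/-- The properties which characterize `ℚ_x^{x₀, φ}` among the `σ`-finite measures on `E^ℕ`.
In `integral_eq`, `F` runs over the nonnegative functionals of `X 0, …, X n`. -/
structure IsQMeasure (p : E → PMF E) (x₀ : E) (φ : E → ℝ) (x : E) (Q : Measure (ℕ → E)) :
    Prop where
  sigmaFinite : SigmaFinite Q
  start : Q {ω | ω 0 ≠ x} = 0
  transient : ∀ y, Q {ω | {n : ℕ | 1 ≤ n ∧ ω n = y}.Infinite} = 0
  integral_eq : ∀ (n : ℕ) (F : (ℕ → E) → ℝ≥0∞),
    Measurable[Filtration.piLE (X := fun _ : ℕ => E) n] F →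
      ∫⁻ ω, F ω * {ω' : ℕ → E | ∀ k ≥ n, ω' k ≠ x₀}.indicator 1 ω ∂Q =
        ∫⁻ ω, F ω * ENNReal.ofReal (φ (ω n)) ∂(chainLaw p x)

open Classical in
/-- The measure `ℚ_x^{x₀, φ}` (`0` if there is no measure with the properties above). -/
def qMeasure (p : E → PMF E) (x₀ : E) (φ : E → ℝ) (x : E) : Measure (ℕ → E) :=
  if h : ∃ Q, IsQMeasure p x₀ φ x Q then h.choose else 0

/-- The trajectory `(ω 0, …, ω n, ω' 1, ω' 2, …)`. -/
def concat (n : ℕ) (ω : (ℕ → E) × (ℕ → E)) : ℕ → E :=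
  fun k => if k ≤ n then ω.1 k else ω.2 (k - n)

theorem measurable_concat {S : Type*} [MeasurableSpace S] (n : ℕ) :
    Measurable (concat (E := S) n) := by
  refine measurable_pi_lambda _ fun k => ?_
  by_cases h : k ≤ n <;> simp only [concat, h, if_true, if_false] <;> fun_prop

/-- The class `𝒬` of families of `σ`-finite measures associated with the chain. -/
structure ClassQ (p : E → PMF E) (Q : E → Measure (ℕ → E)) : Prop where
  sigmaFinite : ∀ x, SigmaFinite (Q x)
  markov : ∀ (n : ℕ) (x y : E),
    (Q x).restrict {ω | ω n = y} =
      (((chainLaw p x).prod (Q y)).map (concat n)).restrict {ω | ω n = y}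
  finite_avoid : ∀ x₀ x, Q x {ω | ∀ k, ω k ≠ x₀} < ∞
  transient : ∀ x₀ x₁, Q x₁ {ω | {k : ℕ | ω k = x₀}.Infinite} = 0

/-! ### Martin boundary of a recurrent chain -/

/-- The Green function `G_{x₀}(x, y)`: expected number, under `ℙ_x`, of visits to `y` at times
`n < T'`, where `T' = inf {k ≥ 1, X k = x₀}`. -/
def green (p : E → PMF E) (x₀ x y : E) : ℝ≥0∞ :=
  ∫⁻ ω, ∑' n : ℕ, {ω' : ℕ → E | ω' n = y ∧ ∀ k, 1 ≤ k → k ≤ n → ω' k ≠ x₀}.indicator 1 ω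
    ∂(chainLaw p x)

/-- `L_{x₀}(x, y) = G_{x₀}(x, y) / G_{x₀}(x₀, y)`. -/
def martinL (p : E → PMF E) (x₀ x y : E) : ℝ :=
  (green p x₀ x y / green p x₀ x₀ y).toReal

/-- `D_{x₀}(z) = sup_y L_{x₀}(z, y)`. -/
def martinD (p : E → PMF E) (x₀ z : E) : ℝ≥0∞ := ⨆ y, ENNReal.ofReal (martinL p x₀ z y)

/-- The set `E`, to be endowed with the distance `δ_{x₀, w}` instead of any other distance. -/
def MartinBase (_p : E → PMF E) (_x₀ : E) (_w : E → ℝ≥0) : Type _ := E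

/-- The distance
`δ_{x₀, w}(x, y) = ∑_z w_z (|L_{x₀}(z, x) - L_{x₀}(z, y)| + |1_{z = x} - 1_{z = y}|) / (D_{x₀}(z) + 1)`,
as an element of `[0, ∞]`. -/
def martinDist (p : E → PMF E) (x₀ : E) (w : E → ℝ≥0) (x y : E) : ℝ≥0∞ :=
  ∑' z, (w z : ℝ≥0∞) *
    ((edist (martinL p x₀ z x) (martinL p x₀ z y) +
      edist (({x} : Set E).indicator (1 : E → ℝ) z) (({y} : Set E).indicator (1 : E → ℝ) z)) /
        (martinD p x₀ z + 1))

theorem martinDist_comm (p : E → PMF E) (x₀ : E) (w : E → ℝ≥0) (x y : E) :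
    martinDist p x₀ w x y = martinDist p x₀ w y x := by
  refine tsum_congr fun z => ?_
  rw [edist_comm (martinL p x₀ z x), edist_comm (Set.indicator {x} (1 : E → ℝ) z)]

theorem martinDist_triangle (p : E → PMF E) (x₀ : E) (w : E → ℝ≥0) (x y u : E) :
    martinDist p x₀ w x u ≤ martinDist p x₀ w x y + martinDist p x₀ w y u := by
  unfold martinDist
  rw [← ENNReal.tsum_add]
  refine ENNReal.tsum_le_tsum fun z => ?_
  rw [← mul_add, ← ENNReal.add_div, add_add_add_comm]
  gcongr <;> exact edist_triangle _ _ _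

instance (p : E → PMF E) (x₀ : E) (w : E → ℝ≥0) : PseudoEMetricSpace (MartinBase p x₀ w) where
  edist := martinDist (E := E) p x₀ w
  edist_self x := (by simp [martinDist] : ∀ y : E, martinDist p x₀ w y y = 0) x
  edist_comm := martinDist_comm p x₀ w
  edist_triangle := martinDist_triangle p x₀ w

/-- The Martin compactification: the completion of `(E, δ_{x₀, w})`. -/
abbrev MartinCompactification (p : E → PMF E) (x₀ : E) (w : E → ℝ≥0) : Type _ :=
  UniformSpace.Completion (MartinBase p x₀ w)

/-- The canonical map from `E` to its Martin compactification. -/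
def toMartin (p : E → PMF E) (x₀ : E) (w : E → ℝ≥0) (x : E) : MartinCompactification p x₀ w :=
  UniformSpace.Completion.coe' (α := MartinBase p x₀ w) x

/-- The Martin boundary `∂E`: the complement of `E` in its Martin compactification. -/
def martinBoundary (p : E → PMF E) (x₀ : E) (w : E → ℝ≥0) :
    Set (MartinCompactification p x₀ w) :=
  (Set.range (toMartin p x₀ w))ᶜ

/-- The extension by (uniform) continuity of `L_{x₀}(x, ·)` to the Martin compactification. -/
def martinLExt (p : E → PMF E) (x₀ : E) (w : E → ℝ≥0) (x : E) :
    MartinCompactification p x₀ w → ℝ :=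
  UniformSpace.Completion.extension (fun y : MartinBase p x₀ w => martinL p x₀ x y)

open Classical in
/-- `h` is harmonic for the killed transitions `p_{x,y} 1_{y ≠ x₀}`. -/
def KilledHarmonic (p : E → PMF E) (x₀ : E) (h : E → ℝ) : Prop :=
  ∀ x, HasSum (fun y => (p x y).toReal * (if y ≠ x₀ then 1 else 0) * h y) (h x)

/-- `h` is minimal harmonic for the killed transitions `p_{x,y} 1_{y ≠ x₀}`. -/
def IsMinimalHarmonic (p : E → PMF E) (x₀ : E) (h : E → ℝ) : Prop :=
  KilledHarmonic p x₀ h ∧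
    ∀ ψ : E → ℝ, KilledHarmonic p x₀ ψ → (∀ x, 0 ≤ ψ x ∧ ψ x ≤ h x) →
      ∃ c ∈ Set.Icc (0 : ℝ) 1, ∀ x, ψ x = c * h x

/-- The minimal boundary `∂ₘE`. -/
def minimalBoundary (p : E → PMF E) (x₀ : E) (w : E → ℝ≥0) :
    Set (MartinCompactification p x₀ w) :=
  {α | α ∈ martinBoundary p x₀ w ∧ IsMinimalHarmonic p x₀ (fun x => martinLExt p x₀ w x α)}

open Classical in
/-- `φ_{x₀, α}(x) = L_{x₀}(x, α) / β(x₀) · 1_{x ≠ x₀}`. -/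
def martinPhi (p : E → PMF E) (β : E → ℝ) (x₀ : E) (w : E → ℝ≥0)
    (α : MartinCompactification p x₀ w) (x : E) : ℝ :=
  martinLExt p x₀ w x α / β x₀ * (if x ≠ x₀ then 1 else 0)

/-- `ℚ_x^α = ℚ_x^{x₀, φ_{x₀, α}}`. -/
def martinQ (p : E → PMF E) (β : E → ℝ) (x₀ : E) (w : E → ℝ≥0)
    (α : MartinCompactification p x₀ w) (x : E) : Measure (ℕ → E) :=
  qMeasure p x₀ (martinPhi p β x₀ w α) x

end Chain

/-! ### The simple random walk -/

/-- Transition probabilities of the simple random walk on `ℤ`. -/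
def srw (x : ℤ) : PMF ℤ :=
  ⟨fun y => if |y - x| = 1 then 2⁻¹ else 0, by
    have h : ∀ y ∉ ({x + 1, x - 1} : Finset ℤ),
        (if |y - x| = 1 then (2⁻¹ : ℝ≥0∞) else 0) = 0 := by
      intro y hy
      simp only [Finset.mem_insert, Finset.mem_singleton, not_or] at hy
      rw [if_neg]
      intro h
      rcases (abs_eq zero_le_one).1 h with h | h <;> omega
    have h2 : HasSum (fun y : ℤ => if |y - x| = 1 then (2⁻¹ : ℝ≥0∞) else 0) _ :=
      hasSum_sum_of_ne_finset_zero h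
    rw [Finset.sum_pair (by omega)] at h2
    simpa [ENNReal.inv_two_add_inv_two] using h2⟩

end

end RecMartin

/-! Everything rests on one computation: a function vanishing at 0 and harmonic elsewhere satisfies
the midpoint relation on each half-line, so it is linear there and determined by its values at 1 and
-1 (`eq_of_harmonicOff_srw`). The nonnegative ones form a cone with two extremal rays.

Green function: it is the least nonnegative solution of its last-step recursion (`green_recursion`,
`green_le`). The explicit kernel `greenVal` solves the same recursion, so the difference, as a
function of the endpoint, is nonnegative, bounded, zero at 0 and harmonic elsewhere. Being linear on
half-lines, it vanishes (`green_srw`).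

Martin boundary: the kernel at a fixed `z` is constant once the second argument has passed `|z|` on
either side. Hence both ends of the line are Cauchy for the Martin distance
(`exists_tendsto_toMartin`). An ultrafilter on the integers is principal or finer than `atTop` or
`atBot`, so there are no further limit points.

Measures: the trajectories avoiding `x₀` from time `n` on increase, as `n` grows, to a set of full
measure, so a transient measure is determined by the mass of cylinders intersected with these sets,
provided that they have finite mass (`ext_of_avoidFrom`). This gives uniqueness and the Markov
property. For existence, the trajectory is cut at its last visit to `x₀`: the original chain runs
before it, the Doob transform by `φ` after it (`lastExit_cyl`).

The class: any member of it is the family associated with `φ(y) = Q_y(0 is never hit)`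
(`ClassQ.isQMeasure`), which is harmonic off 0 (`ClassQ.harmonicOff`) and so a combination of the
two extremal functions. Uniqueness carries the combination over to the measures. -/

namespace RecMartin

/-! ### Cylinders, and measures determined by them -/

section Cylinder

variable {E : Type*}

/-- The trajectories which coincide with `s` up to time `n`. -/
def cyl (n : ℕ) (s : ℕ → E) : Set (ℕ → E) := {ω | ∀ i ≤ n, ω i = s i}

/-- The trajectories which avoid `x₀` from time `n` on. -/
def avoidFrom (x₀ : E) (n : ℕ) : Set (ℕ → E) := {ω | ∀ k ≥ n, ω k ≠ x₀}

theorem avoidFrom_mono (x₀ : E) : Monotone (avoidFrom x₀) :=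
  fun _ _ h _ hω k hk => hω k (h.trans hk)

theorem not_infinite_iff_exists_avoidFrom (x₀ : E) (ω : ℕ → E) :
    ¬ {k : ℕ | ω k = x₀}.Infinite ↔ ∃ n, ω ∈ avoidFrom x₀ n := by
  rw [Set.not_infinite]
  refine ⟨fun h => ?_, fun ⟨n, hn⟩ => (Set.finite_lt_nat n).subset fun k hk => ?_⟩
  · obtain ⟨N, hN⟩ := h.bddAbove
    exact ⟨N + 1, fun k hk h0 => by have := hN h0; omega⟩
  · by_contra h
    exact hn k (not_lt.1 h) hk

/-- `IsQMeasure` counts visits from time 1 and `ClassQ` from time 0; removing one time does not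
affect infinitude. -/
theorem not_infinite_iff_exists_avoidFrom' (x₀ : E) (ω : ℕ → E) :
    ¬ {k : ℕ | 1 ≤ k ∧ ω k = x₀}.Infinite ↔ ∃ n, ω ∈ avoidFrom x₀ n := by
  rw [← not_infinite_iff_exists_avoidFrom, not_iff_not]
  refine ⟨fun h => h.mono fun k hk => hk.2, fun h => ?_⟩
  refine (h.sdiff (Set.finite_singleton 0)).mono fun k hk => ⟨?_, hk.1⟩
  have : k ≠ 0 := hk.2
  omega

theorem cyl_eq_preimage (n : ℕ) (s : ℕ → E) : cyl n s =
    Preorder.frestrictLe (π := fun _ => E) n ⁻¹' ({fun i => s i.1} : Set (Π _ : Finset.Iic n, E)) := by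
  ext ω
  simp only [cyl, Set.mem_ofPred_eq, Set.mem_preimage, Set.mem_singleton_iff, funext_iff,
    Preorder.frestrictLe_apply, Subtype.forall, Finset.mem_Iic]

variable [MeasurableSpace E] [MeasurableSingletonClass E]

theorem measurableSet_eval_eq (n : ℕ) (y : E) : MeasurableSet {ω : ℕ → E | ω n = y} :=
  (measurable_pi_apply (X := fun _ : ℕ => E) n) (MeasurableSet.singleton y)

theorem measurableSet_cyl (n : ℕ) (s : ℕ → E) : MeasurableSet (cyl n s) := by
  rw [cyl_eq_preimage]
  exact Preorder.measurable_frestrictLe n (MeasurableSet.singleton _)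

theorem measurableSet_avoidFrom (x₀ : E) (n : ℕ) : MeasurableSet (avoidFrom x₀ n) := by
  have : avoidFrom x₀ n = ⋂ k, ⋂ (_ : n ≤ k), {ω : ℕ → E | ω k = x₀}ᶜ := by
    ext ω; simp [avoidFrom]
  rw [this]
  exact MeasurableSet.iInter fun k => MeasurableSet.iInter fun _ => (measurableSet_eval_eq k x₀).compl

theorem measurableSet_piLE_eval (n : ℕ) {k : ℕ} (hk : k ≤ n) (y : E) :
    MeasurableSet[Filtration.piLE (X := fun _ : ℕ => E) n] {ω : ℕ → E | ω k = y} := by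
  rw [Filtration.piLE_eq_comap_frestrictLe]
  exact ⟨{t | t ⟨k, Finset.mem_Iic.2 hk⟩ = y},
    measurable_pi_apply (X := fun _ : Finset.Iic n => E) _ (MeasurableSet.singleton y), rfl⟩

theorem measurableSet_piLE_cyl (n : ℕ) (s : ℕ → E) :
    MeasurableSet[Filtration.piLE (X := fun _ : ℕ => E) n] (cyl n s) := by
  rw [Filtration.piLE_eq_comap_frestrictLe, cyl_eq_preimage]
  exact ⟨_, MeasurableSet.singleton _, rfl⟩

variable [Countable E]

/-- There are countably many histories up to time `n`, so their law is determined by its atoms. -/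
theorem map_frestrictLe_eq_of_cyl {μ ν : Measure (ℕ → E)} {n : ℕ}
    (h : ∀ s, μ (cyl n s) = ν (cyl n s)) :
    μ.map (Preorder.frestrictLe n) = ν.map (Preorder.frestrictLe n) := by
  refine Measure.ext_of_singleton fun t => ?_
  -- Past time `n` the history is extended by an arbitrary value, here the one at time 0.
  have ht : (fun i : Finset.Iic n => (fun k : ℕ => if hk : k ≤ n then t ⟨k, Finset.mem_Iic.2 hk⟩
      else t ⟨0, Finset.mem_Iic.2 (Nat.zero_le n)⟩) i.1) = t := by
    funext i
    simp [Finset.mem_Iic.1 i.2]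
  rw [Measure.map_apply (Preorder.measurable_frestrictLe n) (MeasurableSet.singleton _),
    Measure.map_apply (Preorder.measurable_frestrictLe n) (MeasurableSet.singleton _), ← ht,
    ← cyl_eq_preimage n (fun k : ℕ => if hk : k ≤ n then t ⟨k, Finset.mem_Iic.2 hk⟩
      else t ⟨0, Finset.mem_Iic.2 (Nat.zero_le n)⟩)]
  exact h _

theorem measure_eq_of_cyl {μ ν : Measure (ℕ → E)} {n : ℕ}
    (h : ∀ s, μ (cyl n s) = ν (cyl n s)) {B : Set (ℕ → E)}
    (hB : MeasurableSet[Filtration.piLE (X := fun _ : ℕ => E) n] B) : μ B = ν B := by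
  rw [Filtration.piLE_eq_comap_frestrictLe] at hB
  obtain ⟨C, hC, rfl⟩ := hB
  rw [← Measure.map_apply (Preorder.measurable_frestrictLe n) hC,
    ← Measure.map_apply (Preorder.measurable_frestrictLe n) hC, map_frestrictLe_eq_of_cyl h]

theorem lintegral_eq_of_cyl {μ ν : Measure (ℕ → E)} {n : ℕ}
    (h : ∀ s, μ (cyl n s) = ν (cyl n s)) {F : (ℕ → E) → ℝ≥0∞}
    (hF : Measurable[Filtration.piLE (X := fun _ : ℕ => E) n] F) :
    ∫⁻ ω, F ω ∂μ = ∫⁻ ω, F ω ∂ν := by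
  have hle := (Filtration.piLE (X := fun _ : ℕ => E)).le n
  rw [← lintegral_trim hle hF, ← lintegral_trim hle hF]
  congr 1
  refine @Measure.ext _ (_) _ _ fun B hB => ?_
  rw [trim_measurableSet_eq hle hB, trim_measurableSet_eq hle hB]
  exact measure_eq_of_cyl h hB

/-- Any finite set of times lies in an initial segment ending after `n`, so long cylinders fix all
finite-dimensional marginals; projective limits of finite measures are unique. -/
theorem ext_of_cyl {μ ν : Measure (ℕ → E)} [IsFiniteMeasure μ] {n : ℕ}
    (h : ∀ k ≥ n, ∀ s, μ (cyl k s) = ν (cyl k s)) : μ = ν := by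
  have hν : ∀ I : Finset ℕ, μ.map I.restrict = ν.map I.restrict := by
    intro I
    let k := max n (I.sup id)
    have hI : I ⊆ Finset.Iic k := fun i hi =>
      Finset.mem_Iic.2 ((Finset.le_sup (f := id) hi).trans (le_max_right _ _))
    have h1 : I.restrict (π := fun _ : ℕ => E) =
        Finset.restrict₂ (π := fun _ : ℕ => E) hI ∘ Preorder.frestrictLe k := rfl
    rw [h1, ← Measure.map_map (Finset.measurable_restrict₂ hI) (Preorder.measurable_frestrictLe k),
      ← Measure.map_map (Finset.measurable_restrict₂ hI) (Preorder.measurable_frestrictLe k),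
      map_frestrictLe_eq_of_cyl (h k (le_max_left _ _))]
  exact IsProjectiveLimit.unique (P := fun I => μ.map I.restrict) (fun I => rfl)
    (fun I => (hν I).symm)

/-- It suffices to compare restrictions to `avoidFrom x₀ n`, which are finite. For `k ≥ n`, a
cylinder up to time `k` either visits `x₀` during `[n, k)` and misses this set, or meets it exactly
as it meets `avoidFrom x₀ k`. The threshold `N` serves the Markov property at time `N`, where only
later cylinders are computable. -/
theorem ext_of_avoidFrom {μ ν : Measure (ℕ → E)} (x₀ : E) (N : ℕ)
    (hfin : ∀ n ≥ N, μ (avoidFrom x₀ n) < ∞)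
    (h : ∀ n ≥ N, ∀ s, μ (cyl n s ∩ avoidFrom x₀ n) = ν (cyl n s ∩ avoidFrom x₀ n))
    (hμ : ∀ᵐ ω ∂μ, ∃ n, ω ∈ avoidFrom x₀ n) (hν : ∀ᵐ ω ∂ν, ∃ n, ω ∈ avoidFrom x₀ n) :
    μ = ν := by
  have key : ∀ n ≥ N, μ.restrict (avoidFrom x₀ n) = ν.restrict (avoidFrom x₀ n) := by
    intro n hn
    have : IsFiniteMeasure (μ.restrict (avoidFrom x₀ n)) :=
      ⟨by rw [Measure.restrict_apply_univ]; exact hfin n hn⟩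
    refine ext_of_cyl (n := n) fun k hk s => ?_
    rw [Measure.restrict_apply (measurableSet_cyl k s), Measure.restrict_apply (measurableSet_cyl k s)]
    by_cases hs : ∀ i, n ≤ i → i < k → s i ≠ x₀
    · have : cyl k s ∩ avoidFrom x₀ n = cyl k s ∩ avoidFrom x₀ k := by
        ext ω
        refine and_congr_right fun hω => ⟨fun h => avoidFrom_mono x₀ hk h, fun h i hi => ?_⟩
        rcases lt_or_ge i k with hik | hik
        · rw [hω i hik.le]; exact hs i hi hik
        · exact h i hik
      rw [this, h k (hn.trans hk)]
    · push Not at hs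
      obtain ⟨i, hi, hik, hs⟩ := hs
      have : cyl k s ∩ avoidFrom x₀ n = ∅ := by
        ext ω
        simp only [Set.mem_inter_iff, Set.mem_empty_iff_false, iff_false, not_and]
        exact fun hω h => h i hi ((hω i hik.le).trans hs)
      simp [this]
  have hU : ∀ {ρ : Measure (ℕ → E)}, (∀ᵐ ω ∂ρ, ∃ n, ω ∈ avoidFrom x₀ n) →
      ρ.restrict (⋃ n, avoidFrom x₀ (N + n)) = ρ := fun {ρ} hρ => by
    refine Measure.restrict_eq_self_of_ae_mem ?_
    filter_upwards [hρ] with ω ⟨n, hn⟩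
    exact Set.mem_iUnion.2 ⟨n, avoidFrom_mono x₀ (Nat.le_add_left _ _) hn⟩
  rw [← hU hμ, ← hU hν, Measure.restrict_iUnion_congr]
  exact fun n => key _ (Nat.le_add_right _ _)

theorem measurable_piLE_eval (n : ℕ) (f : E → ℝ≥0∞) :
    Measurable[Filtration.piLE (X := fun _ : ℕ => E) n] fun ω : ℕ → E => f (ω n) := by
  rw [Filtration.piLE_eq_comap_frestrictLe]
  exact (measurable_of_countable f).comp ((measurable_pi_apply
    (X := fun _ : Finset.Iic n => E) ⟨n, Finset.mem_Iic.2 le_rfl⟩).comp (comap_measurable _))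

end Cylinder

/-! ### Concatenation of trajectories -/

section Concat

variable {E : Type*} [MeasurableSpace E] [MeasurableSingletonClass E]

/-- The event splits into a condition on each factor. `concat` discards the starting point of the
second trajectory, so `hQ` is needed to recover its condition at time 0. -/
theorem concat_cyl (μ Q : Measure (ℕ → E)) [SFinite μ] [SFinite Q] (x₀ : E) (s : ℕ → E) {n m : ℕ}
    (hnm : n ≤ m) (hQ : ∀ᵐ ω ∂Q, ω 0 = s n) :
    ((μ.prod Q).map (concat n)) (cyl m s ∩ avoidFrom x₀ m) =
      μ (cyl n s) * Q (cyl (m - n) (fun i => s (n + i)) ∩ avoidFrom x₀ (m - n)) := by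
  rw [Measure.map_apply (measurable_concat n)
    ((measurableSet_cyl m s).inter (measurableSet_avoidFrom x₀ m)), ← Measure.prod_prod]
  refine measure_congr ?_
  have h0 : ∀ᵐ z ∂(μ.prod Q), z.2 0 = s n :=
    Measure.quasiMeasurePreserving_snd.ae hQ
  filter_upwards [h0] with z hz
  refine propext ⟨fun ⟨h1, h2⟩ => ⟨fun i hi => ?_, fun i hi => ?_, fun k hk => ?_⟩,
    fun ⟨h1, h2, h3⟩ => ⟨fun i hi => ?_, fun k hk => ?_⟩⟩
  · have := h1 i (hi.trans hnm)
    simpa [concat, hi] using this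
  · rcases Nat.eq_zero_or_pos i with rfl | hi0
    · simpa using hz
    · have := h1 (n + i) (by omega)
      simpa [concat, hi0.ne'] using this
  · have := h2 (n + k) (by omega)
    rcases Nat.eq_zero_or_pos k with rfl | hk0
    · have h3 := h1 n hnm
      simp only [concat, le_refl, if_true, add_zero] at this h3
      rwa [hz, ← h3]
    · simpa [concat, hk0.ne'] using this
  · by_cases hin : i ≤ n
    · simpa [concat, hin] using h1 i hin
    · have := h2 (i - n) (by omega)
      simpa [concat, hin, show n + (i - n) = i by omega] using this
  · by_cases hkn : k ≤ n
    · obtain rfl : k = n := by omega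
      have := h3 0 (by omega)
      simpa [concat, h1 k le_rfl, ← hz] using this
    · simpa [concat, hkn] using h3 (k - n) (by omega)

variable [Countable E]

theorem chainLaw_start (p : E → PMF E) (x : E) : ∀ᵐ ω ∂(chainLaw p x), ω 0 = x := by
  have h := chainLaw_cylinder p x (fun _ => x) 0
  simp only [if_true, Finset.range_zero, Finset.prod_empty, mul_one] at h
  have h2 : ∀ᵐ ω ∂(chainLaw p x), ω ∈ {ω : ℕ → E | ∀ i ≤ 0, ω i = x} :=
    (mem_ae_iff_prob_eq_one (measurableSet_cyl 0 fun _ => x)).2 h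
  filter_upwards [h2] with ω hω using hω 0 le_rfl

theorem chainLaw_cyl_of_ne (p : E → PMF E) {x : E} {s : ℕ → E} (n : ℕ) (h : s 0 ≠ x) :
    chainLaw p x (cyl n s) = 0 := by
  rw [cyl, chainLaw_cylinder, if_neg h, zero_mul]

theorem chainLaw_cyl (p : E → PMF E) (s : ℕ → E) (n : ℕ) :
    chainLaw p (s 0) (cyl n s) = ∏ i ∈ Finset.range n, p (s i) (s (i + 1)) := by
  rw [cyl, chainLaw_cylinder, if_pos rfl, one_mul]

theorem chainLaw_cyl_mul (p : E → PMF E) (x : E) (s : ℕ → E) {n m : ℕ} (hnm : n ≤ m) :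
    chainLaw p x (cyl n s) * chainLaw p (s n) (cyl (m - n) fun i => s (n + i)) =
      chainLaw p x (cyl m s) := by
  by_cases h : s 0 = x
  · subst h
    have := chainLaw_cyl p (fun i => s (n + i)) (m - n)
    simp only [add_zero] at this
    rw [chainLaw_cyl, this, chainLaw_cyl]
    obtain ⟨d, rfl⟩ := Nat.exists_eq_add_of_le hnm
    rw [Nat.add_sub_cancel_left, Finset.prod_range_add]
    rfl
  · rw [chainLaw_cyl_of_ne p n h, chainLaw_cyl_of_ne p m h, zero_mul]

end Concat

/-! ### Cylinder form and uniqueness of the measures -/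

section QMeasure

variable {E : Type*} [Countable E] [MeasurableSpace E] [MeasurableSingletonClass E]
  {p : E → PMF E} {x₀ x : E} {φ : E → ℝ} {Q : Measure (ℕ → E)}

/-- The two sides integrate `F` against a restriction of `Q` and against the chain law with density
`φ(X_n)`; these agree on cylinders, hence on all events up to time `n`. -/
theorem lintegral_avoidFrom_of_cyl {n : ℕ}
    (h : ∀ s, Q (cyl n s ∩ avoidFrom x₀ n) =
      chainLaw p x (cyl n s) * ENNReal.ofReal (φ (s n)))
    {F : (ℕ → E) → ℝ≥0∞} (hF : Measurable[Filtration.piLE (X := fun _ : ℕ => E) n] F) :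
    ∫⁻ ω, F ω * {ω' : ℕ → E | ∀ k ≥ n, ω' k ≠ x₀}.indicator 1 ω ∂Q =
        ∫⁻ ω, F ω * ENNReal.ofReal (φ (ω n)) ∂(chainLaw p x) := by
  have hle := (Filtration.piLE (X := fun _ : ℕ => E)).le n
  have hφ : Measurable fun ω : ℕ → E => ENNReal.ofReal (φ (ω n)) :=
    (measurable_piLE_eval n fun z => ENNReal.ofReal (φ z)).mono hle le_rfl
  have h1 : ∀ ω, F ω * {ω' : ℕ → E | ∀ k ≥ n, ω' k ≠ x₀}.indicator 1 ω =
      (avoidFrom x₀ n).indicator F ω := by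
    intro ω
    by_cases hω : ω ∈ avoidFrom x₀ n
    · rw [Set.indicator_of_mem hω, Set.indicator_of_mem (s := {ω' : ℕ → E | ∀ k ≥ n, ω' k ≠ x₀}) hω,
        Pi.one_apply, mul_one]
    · rw [Set.indicator_of_notMem hω,
        Set.indicator_of_notMem (s := {ω' : ℕ → E | ∀ k ≥ n, ω' k ≠ x₀}) hω, mul_zero]
  have h2 := lintegral_withDensity_eq_lintegral_mul (chainLaw p x) hφ (hF.mono hle le_rfl)
  simp only [Pi.mul_apply] at h2
  simp_rw [h1, mul_comm (F _)]
  rw [lintegral_indicator (measurableSet_avoidFrom x₀ n), ← h2]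
  refine lintegral_eq_of_cyl (fun s => ?_) hF
  rw [Measure.restrict_apply (measurableSet_cyl n s), h,
    withDensity_apply _ (measurableSet_cyl n s),
    setLIntegral_congr_fun (g := fun _ => ENNReal.ofReal (φ (s n))) (measurableSet_cyl n s)
      (fun ω hω => by simp only [hω n le_rfl]), setLIntegral_const, mul_comm]

namespace IsQMeasure

theorem cyl (hQ : IsQMeasure p x₀ φ x Q) (n : ℕ) (s : ℕ → E) :
    Q (cyl n s ∩ avoidFrom x₀ n) = chainLaw p x (cyl n s) * ENNReal.ofReal (φ (s n)) := by
  have h := hQ.integral_eq n ((RecMartin.cyl n s).indicator 1)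
    (measurable_const.indicator (measurableSet_piLE_cyl n s))
  have h1 : ∀ ω, (RecMartin.cyl n s).indicator (1 : (ℕ → E) → ℝ≥0∞) ω *
      {ω' : ℕ → E | ∀ k ≥ n, ω' k ≠ x₀}.indicator 1 ω =
        (RecMartin.cyl n s ∩ avoidFrom x₀ n).indicator 1 ω := fun ω => by
    rw [Set.inter_indicator_one]; rfl
  have h2 : ∀ ω, (RecMartin.cyl n s).indicator (1 : (ℕ → E) → ℝ≥0∞) ω * ENNReal.ofReal (φ (ω n)) =
      (RecMartin.cyl n s).indicator (fun _ => ENNReal.ofReal (φ (s n))) ω := fun ω => by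
    by_cases hω : ω ∈ RecMartin.cyl n s
    · simp [hω, hω n le_rfl]
    · simp [hω]
  simp_rw [h1, h2] at h
  rwa [lintegral_indicator_one ((measurableSet_cyl n s).inter (measurableSet_avoidFrom x₀ n)),
    lintegral_indicator_const (measurableSet_cyl n s), mul_comm] at h

theorem ae_start (hQ : IsQMeasure p x₀ φ x Q) : ∀ᵐ ω ∂Q, ω 0 = x := hQ.start

theorem ae_avoidFrom (hQ : IsQMeasure p x₀ φ x Q) (y : E) :
    ∀ᵐ ω ∂Q, ∃ n, ω ∈ avoidFrom y n := by
  have : ∀ᵐ ω ∂Q, ¬ {k : ℕ | 1 ≤ k ∧ ω k = y}.Infinite := by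
    simpa [ae_iff] using hQ.transient y
  filter_upwards [this] with ω hω using (not_infinite_iff_exists_avoidFrom' y ω).1 hω

theorem measure_avoidFrom (hQ : IsQMeasure p x₀ φ x Q) (n : ℕ) :
    Q (avoidFrom x₀ n) = ∫⁻ ω, ENNReal.ofReal (φ (ω n)) ∂(chainLaw p x) := by
  have h := hQ.integral_eq n 1 measurable_const
  simp only [Pi.one_apply, one_mul] at h
  rw [← h]
  exact (lintegral_indicator_one (measurableSet_avoidFrom x₀ n)).symm

theorem mk_of_cyl [SigmaFinite Q] (h0 : ∀ᵐ ω ∂Q, ω 0 = x)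
    (ht : ∀ y, ∀ᵐ ω ∂Q, ∃ n, ω ∈ avoidFrom y n)
    (h : ∀ n s, Q (RecMartin.cyl n s ∩ avoidFrom x₀ n) =
      chainLaw p x (RecMartin.cyl n s) * ENNReal.ofReal (φ (s n))) : IsQMeasure p x₀ φ x Q where
  sigmaFinite := inferInstance
  start := h0
  transient y := by
    have : ∀ᵐ ω ∂Q, ¬ {k : ℕ | 1 ≤ k ∧ ω k = y}.Infinite := by
      filter_upwards [ht y] with ω hω using (not_infinite_iff_exists_avoidFrom' y ω).2 hω
    simpa [ae_iff] using this
  integral_eq n _ hF := lintegral_avoidFrom_of_cyl (h n) hF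

theorem unique {Q' : Measure (ℕ → E)}
    (hfin : ∀ n, ∫⁻ ω, ENNReal.ofReal (φ (ω n)) ∂(chainLaw p x) < ∞)
    (hQ : IsQMeasure p x₀ φ x Q) (hQ' : IsQMeasure p x₀ φ x Q') : Q = Q' :=
  ext_of_avoidFrom x₀ 0 (fun n _ => by rw [hQ.measure_avoidFrom]; exact hfin n)
    (fun n _ s => by rw [hQ.cyl, hQ'.cyl]) (hQ.ae_avoidFrom x₀) (hQ'.ae_avoidFrom x₀)

end IsQMeasure

end QMeasure

end RecMartin

namespace RecMartin

/-! ### One-step Markov property -/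

section Step

variable {E : Type*} [Countable E] [MeasurableSpace E] [MeasurableSingletonClass E]

theorem chainLaw_inter_step (p : E → PMF E) (x : E) (n : ℕ) (z y : E) {B : Set (ℕ → E)}
    (hB : MeasurableSet[Filtration.piLE (X := fun _ : ℕ => E) n] B) :
    chainLaw p x (B ∩ ({ω | ω n = z} ∩ {ω | ω (n + 1) = y})) =
      chainLaw p x (B ∩ {ω | ω n = z}) * p z y := by
  have hle := (Filtration.piLE (X := fun _ : ℕ => E)).le n
  have hm1 : MeasurableSet ({ω : ℕ → E | ω n = z} ∩ {ω | ω (n + 1) = y}) :=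
    (measurableSet_eval_eq n z).inter (measurableSet_eval_eq (n + 1) y)
  have key : (chainLaw p x).restrict ({ω | ω n = z} ∩ {ω | ω (n + 1) = y}) B =
      (p z y • (chainLaw p x).restrict {ω | ω n = z}) B := by
    refine measure_eq_of_cyl (fun s => ?_) hB
    rw [Measure.smul_apply, Measure.restrict_apply (measurableSet_cyl n s),
      Measure.restrict_apply (measurableSet_cyl n s), smul_eq_mul]
    by_cases hs : s n = z
    · have h1 : cyl n s ∩ {ω | ω n = z} = cyl n s :=
        Set.inter_eq_left.2 fun ω hω => (hω n le_rfl).trans hs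
      -- Extending the cylinder by the value `y` turns the event into a single longer cylinder.
      let t : ℕ → E := fun i => if i ≤ n then s i else y
      have ht : ∀ i ≤ n, t i = s i := fun i hi => if_pos hi
      have ht' : t (n + 1) = y := if_neg (by omega)
      have h2 : cyl n s ∩ ({ω | ω n = z} ∩ {ω | ω (n + 1) = y}) = cyl (n + 1) t := by
        rw [← Set.inter_assoc, h1]
        ext ω
        refine ⟨fun ⟨h, h'⟩ i hi => ?_, fun h => ⟨fun i hi => ?_, ?_⟩⟩
        · rcases Nat.le_succ_iff.1 hi with hi | rfl
          · rw [ht i hi, h i hi]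
          · exact h'.trans ht'.symm
        · rw [h i (by omega), ht i hi]
        · exact (h _ le_rfl).trans ht'
      have h3 : cyl n s = cyl n t := by
        ext ω
        exact forall₂_congr fun i hi => by rw [ht i hi]
      rw [h1, h2, h3, cyl, cyl, chainLaw_cylinder, chainLaw_cylinder, Finset.prod_range_succ, ht',
        ht n le_rfl, hs, mul_comm (p z y), mul_assoc]
    · have h1 : cyl n s ∩ {ω | ω n = z} = ∅ := by
        ext ω
        simp only [Set.mem_inter_iff, Set.mem_empty_iff_false, iff_false, not_and]
        exact fun hω h => hs ((hω n le_rfl).symm.trans h)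
      rw [← Set.inter_assoc, h1]
      simp
  rwa [Measure.smul_apply, Measure.restrict_apply (hle _ hB), Measure.restrict_apply (hle _ hB),
    smul_eq_mul, mul_comm] at key

theorem ae_step (p : E → PMF E) (x : E) :
    ∀ᵐ ω ∂(chainLaw p x), ∀ k, p (ω k) (ω (k + 1)) ≠ 0 := by
  refine ae_all_iff.2 fun k => ?_
  have h : ∀ z y, p z y = 0 → ∀ᵐ ω ∂(chainLaw p x), ¬ (ω k = z ∧ ω (k + 1) = y) := by
    intro z y hzy
    have := chainLaw_inter_step p x k z y MeasurableSet.univ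
    rw [hzy, mul_zero, Set.univ_inter] at this
    rw [ae_iff]
    simpa [Set.ofPred_and] using this
  have h' : ∀ᵐ ω ∂(chainLaw p x), ∀ z y, p z y = 0 → ¬ (ω k = z ∧ ω (k + 1) = y) :=
    ae_all_iff.2 fun z => ae_all_iff.2 fun y => by
      by_cases hzy : p z y = 0
      · filter_upwards [h z y hzy] with ω hω _ using hω
      · exact ae_of_all _ fun ω h => absurd h hzy
  filter_upwards [h'] with ω hω h0 using hω _ _ h0 ⟨rfl, rfl⟩

theorem chainLaw_eval_one (p : E → PMF E) (x y : E) :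
    chainLaw p x {ω | ω 1 = y} = p x y := by
  have h1 := chainLaw_inter_step p x 0 x y MeasurableSet.univ
  have h2 : chainLaw p x {ω | ω 0 = x} = 1 :=
    (mem_ae_iff_prob_eq_one (measurableSet_eval_eq 0 x)).1 (chainLaw_start p x)
  rw [Set.univ_inter, Set.univ_inter, h2, one_mul] at h1
  rw [← h1]
  refine measure_congr ?_
  filter_upwards [chainLaw_start p x] with ω hω
  exact propext ⟨fun h => ⟨hω, h⟩, fun h => h.2⟩

theorem lintegral_eval_one (p : E → PMF E) (x : E) (f : E → ℝ≥0∞) :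
    ∫⁻ ω, f (ω 1) ∂(chainLaw p x) = ∑' y, p x y * f y := by
  have h := lintegral_map (μ := chainLaw p x) (g := fun ω : ℕ → E => ω 1)
    (measurable_of_countable f) (measurable_pi_apply 1)
  rw [← h, lintegral_countable']
  refine tsum_congr fun y => ?_
  rw [Measure.map_apply (measurable_pi_apply 1) (MeasurableSet.singleton y), mul_comm,
    ← chainLaw_eval_one]
  rfl

end Step

/-! ### Recursion and minimality of the Green function -/

section Green

variable {E : Type*} [MeasurableSpace E] [MeasurableSingletonClass E]

/-- The trajectories which visit `y` at time `n`, strictly before the first return to `x₀`. -/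
def visit (x₀ : E) (n : ℕ) (y : E) : Set (ℕ → E) :=
  {ω | ω n = y ∧ ∀ k, 1 ≤ k → k ≤ n → ω k ≠ x₀}

theorem measurableSet_piLE_visit (x₀ : E) (n : ℕ) (y : E) :
    MeasurableSet[Filtration.piLE (X := fun _ : ℕ => E) n] (visit x₀ n y) := by
  have : visit x₀ n y = {ω | ω n = y} ∩
      ⋂ k, ⋂ (_ : 1 ≤ k), ⋂ (_ : k ≤ n), {ω : ℕ → E | ω k = x₀}ᶜ := by
    ext ω; simp [visit]
  rw [this]
  exact (measurableSet_piLE_eval n le_rfl y).inter (MeasurableSet.iInter fun k =>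
    MeasurableSet.iInter fun _ => MeasurableSet.iInter fun hk =>
      (measurableSet_piLE_eval n hk x₀).compl)

theorem measurableSet_visit (x₀ : E) (n : ℕ) (y : E) : MeasurableSet (visit x₀ n y) :=
  (Filtration.piLE (X := fun _ : ℕ => E)).le n _ (measurableSet_piLE_visit x₀ n y)

variable [Countable E]

theorem green_eq_tsum (p : E → PMF E) (x₀ x y : E) :
    green p x₀ x y = ∑' n, chainLaw p x (visit x₀ n y) := by
  change ∫⁻ ω, ∑' n, (visit x₀ n y).indicator 1 ω ∂(chainLaw p x) = _
  rw [lintegral_tsum fun n =>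
    (measurable_one.indicator (measurableSet_visit x₀ n y)).aemeasurable]
  exact tsum_congr fun n => lintegral_indicator_one (measurableSet_visit x₀ n y)

open Classical in
theorem chainLaw_visit_zero (p : E → PMF E) (x₀ x y : E) :
    chainLaw p x (visit x₀ 0 y) = if y = x then 1 else 0 := by
  have h : chainLaw p x (visit x₀ 0 y) = chainLaw p x {_ω | y = x} := by
    refine measure_congr ?_
    filter_upwards [chainLaw_start p x] with ω hω
    refine propext ⟨fun h => h.1.symm.trans hω, fun h => ⟨hω.trans h.symm, fun k h1 h2 => ?_⟩⟩
    omega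
  rw [h]
  split_ifs with hy <;> simp [hy]

open Classical in
-- Decomposition by the position at time `n`; a visit to `x₀` at a positive time is excluded by
-- definition.
theorem chainLaw_visit_succ (p : E → PMF E) (x₀ x y : E) (n : ℕ) :
    chainLaw p x (visit x₀ (n + 1) y) =
      if y = x₀ then 0 else ∑' z, chainLaw p x (visit x₀ n z) * p z y := by
  split_ifs with hy
  · convert measure_empty (μ := chainLaw p x)
    ext ω
    simp only [visit, Set.mem_ofPred_eq, Set.mem_empty_iff_false, iff_false, not_and]
    exact fun h h' => h' (n + 1) (by omega) le_rfl (h.trans hy)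
  · have h1 : visit x₀ (n + 1) y =
        ⋃ z, visit x₀ n z ∩ ({ω | ω n = z} ∩ {ω | ω (n + 1) = y}) := by
      ext ω
      simp only [visit, Set.mem_ofPred_eq, Set.mem_iUnion, Set.mem_inter_iff]
      refine ⟨fun ⟨h, h'⟩ => ⟨ω n, ⟨rfl, fun k hk hk' => h' k hk (by omega)⟩, rfl, h⟩, ?_⟩
      rintro ⟨z, ⟨-, h⟩, -, h'⟩
      refine ⟨h', fun k hk hk' => ?_⟩
      rcases Nat.le_succ_iff.1 hk' with hk' | rfl
      · exact h k hk hk'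
      · rwa [h']
    rw [h1, measure_iUnion]
    · refine tsum_congr fun z => ?_
      rw [chainLaw_inter_step p x n z y (measurableSet_piLE_visit x₀ n z), Set.inter_eq_left.2]
      exact fun ω hω => hω.1
    · intro z z' hz
      refine Set.disjoint_left.2 fun ω h h' => hz ?_
      exact h.1.1.symm.trans h'.1.1
    · exact fun z => (measurableSet_visit x₀ n z).inter
        ((measurableSet_eval_eq n z).inter (measurableSet_eval_eq (n + 1) y))

open Classical in
theorem green_recursion (p : E → PMF E) (x₀ x y : E) :
    green p x₀ x y = (if y = x then 1 else 0) +
      if y = x₀ then 0 else ∑' z, green p x₀ x z * p z y := by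
  rw [green_eq_tsum, tsum_eq_zero_add' ENNReal.summable, chainLaw_visit_zero]
  congr 1
  simp_rw [chainLaw_visit_succ]
  split_ifs with hy
  · simp
  · rw [ENNReal.tsum_comm]
    simp_rw [green_eq_tsum, ENNReal.tsum_mul_right]

open Classical in
-- The partial sums of the Green series are the iterates of the recursion started from 0, so they
-- stay below any supersolution.
theorem green_le (p : E → PMF E) (x₀ x : E) (f : E → ℝ≥0∞)
    (hf : ∀ y, ((if y = x then 1 else 0) + if y = x₀ then 0 else ∑' z, f z * p z y) ≤ f y)
    (y : E) : green p x₀ x y ≤ f y := by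
  rw [green_eq_tsum]
  refine ENNReal.tsum_le_of_sum_range_le fun N => ?_
  induction N generalizing y with
  | zero => simp
  | succ N ih =>
    refine le_trans ?_ (hf y)
    rw [Finset.sum_range_succ', chainLaw_visit_zero, add_comm]
    gcongr
    simp_rw [chainLaw_visit_succ]
    split_ifs with hy
    · simp
    · rw [← Summable.tsum_finsetSum fun _ _ => ENNReal.summable]
      refine ENNReal.tsum_le_tsum fun z => ?_
      rw [← Finset.sum_mul]
      gcongr
      exact ih z

end Green

/-! ### Transience and restriction to the position at a given time -/

section Restrict

variable {E : Type*} [MeasurableSpace E] [MeasurableSingletonClass E]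

theorem ae_map_concat_avoidFrom {μ ν : Measure (ℕ → E)} [SFinite μ] [SFinite ν] (n : ℕ) (y : E)
    (h : ∀ᵐ ω ∂ν, ∃ k, ω ∈ avoidFrom y k) :
    ∀ᵐ ω ∂((μ.prod ν).map (concat n)), ∃ k, ω ∈ avoidFrom y k := by
  have hm : MeasurableSet {ω : ℕ → E | ∃ k, ω ∈ avoidFrom y k} := by
    have : {ω : ℕ → E | ∃ k, ω ∈ avoidFrom y k} = ⋃ k, avoidFrom y k := by ext; simp
    rw [this]
    exact MeasurableSet.iUnion (measurableSet_avoidFrom y)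
  rw [ae_map_iff (measurable_concat n).aemeasurable hm]
  filter_upwards [Measure.quasiMeasurePreserving_snd.ae h] with z ⟨k, hk⟩
  -- The extra 1 matters: the second trajectory is read only strictly after time `n`.
  refine ⟨n + k + 1, fun i hi => ?_⟩
  have : ¬ i ≤ n := by omega
  simpa [concat, this] using hk (i - n) (by omega)

theorem restrict_eval_cyl_of_ne {μ : Measure (ℕ → E)} {n m : ℕ} (hnm : n ≤ m) {s : ℕ → E} {y : E}
    (hs : s n ≠ y) (A : Set (ℕ → E)) : μ.restrict {ω | ω n = y} (cyl m s ∩ A) = 0 := by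
  rw [Measure.restrict_apply' (measurableSet_eval_eq n y)]
  convert measure_empty (μ := μ)
  ext ω
  simp only [Set.mem_inter_iff, Set.mem_empty_iff_false, iff_false, not_and, and_imp]
  exact fun hω _ h => hs ((hω n hnm).symm.trans h)

theorem restrict_eval_cyl_of_eq {μ : Measure (ℕ → E)} {n m : ℕ} (hnm : n ≤ m) {s : ℕ → E} {y : E}
    (hs : s n = y) (A : Set (ℕ → E)) :
    μ.restrict {ω | ω n = y} (cyl m s ∩ A) = μ (cyl m s ∩ A) := by
  rw [Measure.restrict_apply' (measurableSet_eval_eq n y), Set.inter_eq_left.2]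
  exact fun ω hω => (hω.1 n hnm).trans hs

end Restrict

/-! ### Families of measures and the class `𝒬` -/

section Family

variable {E : Type*} [Countable E] [MeasurableSpace E] [MeasurableSingletonClass E]
  {p : E → PMF E} {x₀ : E} {φ : E → ℝ} {Q : E → Measure (ℕ → E)}

/-- On a cylinder longer than `n`, the cylinder formula of `Q y` glued to the chain law gives that
of `Q x`, because chain probabilities multiply. -/
theorem IsQMeasure.markov (hQ : ∀ x, IsQMeasure p x₀ φ x (Q x))
    (hfin : ∀ x n, ∫⁻ ω, ENNReal.ofReal (φ (ω n)) ∂(chainLaw p x) < ∞) (n : ℕ) (x y : E) :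
    (Q x).restrict {ω | ω n = y} =
      (((chainLaw p x).prod (Q y)).map (concat n)).restrict {ω | ω n = y} := by
  have := (hQ y).sigmaFinite
  refine ext_of_avoidFrom x₀ n (fun m hm => ?_) (fun m hm s => ?_) ?_ ?_
  · refine (Measure.restrict_apply_le _ _).trans_lt ?_
    rw [(hQ x).measure_avoidFrom]
    exact hfin x m
  · by_cases hs : s n = y
    · rw [restrict_eval_cyl_of_eq hm hs, restrict_eval_cyl_of_eq hm hs, (hQ x).cyl, concat_cyl _ _ _ _ hm
        (by simpa only [hs] using (hQ y).ae_start), (hQ y).cyl, ← mul_assoc, ← hs,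
        chainLaw_cyl_mul p x s hm, Nat.add_sub_cancel' hm]
    · rw [restrict_eval_cyl_of_ne hm hs, restrict_eval_cyl_of_ne hm hs]
  · exact ae_restrict_of_ae ((hQ x).ae_avoidFrom x₀)
  · exact ae_restrict_of_ae (ae_map_concat_avoidFrom n x₀ ((hQ y).ae_avoidFrom x₀))

/-- The point is finiteness of the mass avoiding an arbitrary `x₁`. Cutting at the last visit to
`x₀` bounds it by the mass that never visits `x₀` plus `green p x₁ x x₀` times the mass of
trajectories from `x₀` that do not return. -/
theorem IsQMeasure.classQ (hQ : ∀ x, IsQMeasure p x₀ φ x (Q x))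
    (hfin : ∀ x n, ∫⁻ ω, ENNReal.ofReal (φ (ω n)) ∂(chainLaw p x) < ∞)
    (hgreen : ∀ x₁ x, x₁ ≠ x₀ → green p x₁ x x₀ < ∞) : ClassQ p Q where
  sigmaFinite x := (hQ x).sigmaFinite
  markov := IsQMeasure.markov hQ hfin
  transient x₁ x := by
    have : ∀ᵐ ω ∂(Q x), ¬ {k : ℕ | ω k = x₁}.Infinite := by
      filter_upwards [(hQ x).ae_avoidFrom x₁] with ω hω
        using (not_infinite_iff_exists_avoidFrom x₁ ω).2 hω
    simpa [ae_iff] using this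
  finite_avoid x₁ x := by
    have hA : ∀ x n, Q x (avoidFrom x₀ n) < ∞ := fun x n => by
      rw [(hQ x).measure_avoidFrom]; exact hfin x n
    by_cases hx : x₁ = x₀
    · subst hx
      refine (measure_mono ?_).trans_lt (hA x 0)
      exact fun ω hω k _ => hω k
    have := (hQ x₀).sigmaFinite
    have hsub : {ω : ℕ → E | ∀ k, ω k ≠ x₁} ⊆ ({ω | ¬ ∃ n, ω ∈ avoidFrom x₀ n} ∪ avoidFrom x₀ 0) ∪
        ⋃ m, visit x₁ m x₀ ∩ avoidFrom x₀ (m + 1) := by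
      -- `Nat.find h` is the first time from which `x₀` is avoided; when positive, its predecessor
      -- is the last visit.
      classical
      intro ω hω
      by_cases h : ∃ n, ω ∈ avoidFrom x₀ n
      · rcases Nat.eq_zero_or_pos (Nat.find h) with h0 | h0
        · exact Or.inl (Or.inr (h0 ▸ Nat.find_spec h))
        · obtain ⟨m, hm⟩ := Nat.exists_eq_succ_of_ne_zero h0.ne'
          have h1 := Nat.find_spec h
          have h2 := Nat.find_min h (m := m) (by omega)
          rw [hm] at h1
          refine Or.inr (Set.mem_iUnion.2 ⟨m, ⟨?_, fun k _ _ => hω k⟩, h1⟩)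
          by_contra h3
          refine h2 fun k hk => ?_
          rcases hk.eq_or_lt with rfl | hk
          · exact h3
          · exact h1 k hk
      · exact Or.inl (Or.inl h)
    have hterm : ∀ m, Q x (visit x₁ m x₀ ∩ avoidFrom x₀ (m + 1)) ≤
        chainLaw p x (visit x₁ m x₀) * Q x₀ (avoidFrom x₀ 1) := by
      intro m
      have hmeas : MeasurableSet (visit x₁ m x₀ ∩ avoidFrom x₀ (m + 1)) :=
        (measurableSet_visit _ _ _).inter (measurableSet_avoidFrom _ _)
      have h1 : Q x (visit x₁ m x₀ ∩ avoidFrom x₀ (m + 1)) =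
          (Q x).restrict {ω | ω m = x₀} (visit x₁ m x₀ ∩ avoidFrom x₀ (m + 1)) := by
        rw [Measure.restrict_apply hmeas]
        congr 1
        exact (Set.inter_eq_left.2 fun ω hω => hω.1.1).symm
      rw [h1, IsQMeasure.markov hQ hfin]
      refine (Measure.restrict_apply_le _ _).trans ?_
      rw [Measure.map_apply (measurable_concat m) hmeas, ← Measure.prod_prod]
      refine measure_mono ?_
      rintro ⟨ω, ω'⟩ ⟨⟨h1, h2⟩, h3⟩
      refine ⟨⟨by simpa [concat] using h1, fun k hk hk' => by simpa [concat, hk'] using h2 k hk hk'⟩,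
        fun k hk => ?_⟩
      have hk0 : ¬ m + k ≤ m := by omega
      simpa [concat, hk0, show k ≠ 0 by omega] using h3 (m + k) (by omega)
    refine (measure_mono hsub).trans_lt ((measure_union_le _ _).trans_lt
      (ENNReal.add_lt_top.2 ⟨(measure_union_le _ _).trans_lt (ENNReal.add_lt_top.2 ⟨?_, hA x 0⟩), ?_⟩))
    · rw [ae_iff.1 ((hQ x).ae_avoidFrom x₀)]
      exact ENNReal.zero_lt_top
    · refine (measure_iUnion_le _).trans_lt ((ENNReal.tsum_le_tsum hterm).trans_lt ?_)
      rw [ENNReal.tsum_mul_right, ← green_eq_tsum]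
      exact ENNReal.mul_lt_top (hgreen x₁ x hx) (hA x₀ 1)

namespace ClassQ

/-- The Markov property at time 0 already forces this, since the glued trajectory takes its starting
point from the chain. -/
theorem ae_start (hQ : ClassQ p Q) (x : E) : ∀ᵐ ω ∂(Q x), ω 0 = x := by
  have h : ∀ y, y ≠ x → ∀ᵐ ω ∂(Q x), ω 0 ≠ y := by
    intro y hy
    have := hQ.sigmaFinite y
    have h1 : Q x {ω | ω 0 = y} = 0 := by
      have h2 := congrArg (fun μ => μ Set.univ) (hQ.markov 0 x y)
      simp only [Measure.restrict_apply_univ] at h2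
      rw [h2, Measure.map_apply (measurable_concat 0) (measurableSet_eval_eq 0 y)]
      have h3 : ∀ᵐ z ∂((chainLaw p x).prod (Q y)), z.1 0 = x :=
        Measure.quasiMeasurePreserving_fst.ae (chainLaw_start p x)
      refine measure_mono_null ?_ (ae_iff.1 h3)
      rintro z (hz : concat 0 z 0 = y) (h0 : z.1 0 = x)
      exact hy (hz.symm.trans h0)
    rw [ae_iff]
    simpa using h1
  have h' : ∀ᵐ ω ∂(Q x), ∀ y, y ≠ x → ω 0 ≠ y := ae_all_iff.2 fun y => by
    by_cases hy : y = x
    · exact ae_of_all _ fun ω h => absurd hy h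
    · filter_upwards [h y hy] with ω hω _ using hω
  filter_upwards [h'] with ω hω
  by_contra h0
  exact hω _ h0 rfl

/-- By the Markov property at time `n`, the mass of a cylinder followed by avoidance of `x₀` factors
through the mass avoiding `x₀` from its endpoint; this dictates `φ`. -/
theorem isQMeasure (hQ : ClassQ p Q) (x₀ x : E) :
    IsQMeasure p x₀ (fun y => (Q y (avoidFrom x₀ 0)).toReal) x (Q x) := by
  have := hQ.sigmaFinite
  refine IsQMeasure.mk_of_cyl (hQ.ae_start x) (fun y => ?_) fun n s => ?_
  · have : ∀ᵐ ω ∂(Q x), ¬ {k : ℕ | ω k = y}.Infinite := by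
      simpa [ae_iff] using hQ.transient y x
    filter_upwards [this] with ω hω using (not_infinite_iff_exists_avoidFrom y ω).1 hω
  · have h0 : Q (s n) (avoidFrom x₀ 0) < ∞ := by
      refine (measure_mono ?_).trans_lt (hQ.finite_avoid x₀ (s n))
      exact fun ω hω k => hω k (Nat.zero_le k)
    rw [ENNReal.ofReal_toReal h0.ne, ← restrict_eval_cyl_of_eq le_rfl rfl, hQ.markov,
      restrict_eval_cyl_of_eq le_rfl rfl, concat_cyl _ _ _ _ le_rfl (hQ.ae_start (s n)), Nat.sub_self]
    congr 1
    refine measure_congr ?_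
    filter_upwards [hQ.ae_start (s n)] with ω hω
    refine propext ⟨fun h => h.2, fun h => ⟨fun i hi => ?_, h⟩⟩
    obtain rfl : i = 0 := by omega
    simpa using hω

theorem toReal_avoidFrom_self (hQ : ClassQ p Q) (x₀ : E) :
    (Q x₀ (avoidFrom x₀ 0)).toReal = 0 := by
  have : Q x₀ (avoidFrom x₀ 0) = 0 := by
    refine measure_mono_null ?_ (ae_iff.1 (hQ.ae_start x₀))
    exact fun ω hω => hω 0 le_rfl
  rw [this, ENNReal.toReal_zero]

/-- From `x ≠ x₀`, avoiding `x₀` from time 0 or from time 1 is the same event, so the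
characterization at time 1 is the mean-value identity. -/
theorem harmonicOff (hQ : ClassQ p Q) (x₀ : E) :
    HarmonicOff p x₀ fun y => (Q y (avoidFrom x₀ 0)).toReal := by
  intro x hx
  have h0 : ∀ y, Q y (avoidFrom x₀ 0) ≠ ∞ := fun y => by
    refine ((measure_mono ?_).trans_lt (hQ.finite_avoid x₀ y)).ne
    exact fun ω hω k => hω k (Nat.zero_le k)
  have h1 : Q x (avoidFrom x₀ 0) = ∑' y, p x y * Q y (avoidFrom x₀ 0) := by
    have h2 := (hQ.isQMeasure x₀ x).measure_avoidFrom 1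
    rw [lintegral_eval_one p x fun y => ENNReal.ofReal (Q y (avoidFrom x₀ 0)).toReal] at h2
    simp_rw [ENNReal.ofReal_toReal (h0 _)] at h2
    rw [← h2]
    refine measure_congr ?_
    filter_upwards [hQ.ae_start x] with ω hω
    refine propext ⟨fun h => avoidFrom_mono x₀ (Nat.zero_le 1) h, fun h k _ => ?_⟩
    rcases Nat.eq_zero_or_pos k with rfl | hk
    · rwa [hω]
    · exact h k hk
  have h3 := ENNReal.hasSum_toReal (h1 ▸ h0 x)
  rw [← ENNReal.tsum_toReal_eq fun y => ENNReal.mul_ne_top ((p x).apply_ne_top y) (h0 y), ← h1] at h3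
  simpa only [ENNReal.toReal_mul] using h3

end ClassQ

end Family

end RecMartin

namespace RecMartin

/-! ### Existence by last-exit decomposition -/

section Existence

variable {E : Type*}

/-- The function `x ↦ ∑_y p(x, y) φ(y)`. -/
noncomputable def transitionSum (p : E → PMF E) (φ : E → ℝ) (x : E) : ℝ≥0∞ :=
  ∑' y, p x y * ENNReal.ofReal (φ y)

open Classical in
/-- Doob's transform of `p` by `φ`, with transitions proportional to `p(x, y) φ(y)`. -/
noncomputable def doob (p : E → PMF E) (φ : E → ℝ) (x : E) : PMF E :=
  if h : transitionSum p φ x ≠ 0 ∧ transitionSum p φ x ≠ ∞ then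
    PMF.normalize (fun y => p x y * ENNReal.ofReal (φ y)) h.1 h.2
  else PMF.pure x

variable {p : E → PMF E} {x₀ : E} {φ : E → ℝ}

/-- When the normalizing mass is 0 every weight is 0, so the identity holds whatever default `doob`
takes. -/
theorem transitionSum_mul_doob {x : E} (hx : transitionSum p φ x ≠ ∞) (y : E) :
    transitionSum p φ x * doob p φ x y = p x y * ENNReal.ofReal (φ y) := by
  by_cases h0 : transitionSum p φ x = 0
  · rw [h0, zero_mul]
    exact (ENNReal.tsum_eq_zero.1 h0 y).symm
  · have h1 : doob p φ x y = p x y * ENNReal.ofReal (φ y) * (transitionSum p φ x)⁻¹ := by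
      rw [doob, dif_pos ⟨h0, hx⟩]
      exact PMF.normalize_apply _ _ _
    rw [h1, mul_comm, mul_assoc, ENNReal.inv_mul_cancel h0 hx, mul_one]

variable [Countable E] [MeasurableSpace E] [MeasurableSingletonClass E]

omit [Countable E] [MeasurableSpace E] [MeasurableSingletonClass E] in
theorem transitionSum_eq (hφ : ∀ x, 0 ≤ φ x) (hh : HarmonicOff p x₀ φ) {x : E} (hx : x ≠ x₀) :
    transitionSum p φ x = ENNReal.ofReal (φ x) := by
  have h := hh x hx
  rw [← h.tsum_eq, ENNReal.ofReal_tsum_of_nonneg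
    (fun y => mul_nonneg ENNReal.toReal_nonneg (hφ y)) h.summable]
  refine tsum_congr fun y => ?_
  rw [ENNReal.ofReal_mul ENNReal.toReal_nonneg, ENNReal.ofReal_toReal ((p x).apply_ne_top y)]

/-- The law of the chain `doob p φ`, multiplied by the mass of `p(x, ·) φ`. -/
noncomputable def excursion (p : E → PMF E) (φ : E → ℝ) (x : E) : Measure (ℕ → E) :=
  transitionSum p φ x • chainLaw (doob p φ) x

theorem excursion_start (x : E) : ∀ᵐ ω ∂(excursion p φ x), ω 0 = x :=
  Measure.ae_smul_measure (chainLaw_start _ x) _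

theorem isFiniteMeasure_excursion (hfin : ∀ x, transitionSum p φ x ≠ ∞) (x : E) :
    IsFiniteMeasure (excursion p φ x) :=
  ⟨by rw [excursion, Measure.smul_apply, measure_univ, smul_eq_mul, mul_one]
      exact (hfin x).lt_top⟩

/-- The Doob weights telescope: each normalization after the first equals `φ` at a point other than
`x₀` and cancels the preceding numerator. The first one cancels the total mass of `excursion`, which
is `transitionSum` rather than `φ` so that the start `x₀`, where `φ` vanishes, is allowed. -/
theorem excursion_cyl (hfin : ∀ x, transitionSum p φ x ≠ ∞)
    (hψ : ∀ x, x ≠ x₀ → transitionSum p φ x = ENNReal.ofReal (φ x)) {x : E} {s : ℕ → E} (n : ℕ)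
    (hs : ∀ j, 1 ≤ j → j ≤ n → s j ≠ x₀) :
    excursion p φ x (cyl (n + 1) s) =
      chainLaw p x (cyl (n + 1) s) * ENNReal.ofReal (φ (s (n + 1))) := by
  rw [excursion, Measure.smul_apply, smul_eq_mul]
  by_cases h0 : s 0 = x
  · subst h0
    rw [chainLaw_cyl, chainLaw_cyl]
    induction n with
    | zero => simpa using transitionSum_mul_doob (hfin (s 0)) (s 1)
    | succ n ih =>
      rw [Finset.prod_range_succ, ← mul_assoc, ih fun j h1 h2 => hs j h1 (by omega),
        Finset.prod_range_succ _ (n + 1), mul_assoc, ← hψ _ (hs (n + 1) (by omega) le_rfl),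
        transitionSum_mul_doob (hfin _), mul_assoc]
  · rw [chainLaw_cyl_of_ne _ _ h0, chainLaw_cyl_of_ne _ _ h0, mul_zero, zero_mul]

/-- From a point of nonzero mass the Doob chain jumps only where `φ` is positive, so never to `x₀`,
and the mass at the new point is again nonzero; the default branch of `doob` is never reached. -/
theorem excursion_avoidFrom (hfin : ∀ x, transitionSum p φ x ≠ ∞) (hφ : φ x₀ = 0)
    (hψ : ∀ x, x ≠ x₀ → transitionSum p φ x = ENNReal.ofReal (φ x)) (x : E) :
    ∀ᵐ ω ∂(excursion p φ x), ω ∈ avoidFrom x₀ 1 := by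
  by_cases h0 : transitionSum p φ x = 0
  · simp [excursion, h0]
  refine Measure.ae_smul_measure ?_ _
  filter_upwards [chainLaw_start (doob p φ) x, ae_step (doob p φ) x] with ω h1 h2
  have hstep : ∀ k, transitionSum p φ (ω k) ≠ 0 → ω (k + 1) ≠ x₀ ∧
      transitionSum p φ (ω (k + 1)) ≠ 0 := by
    intro k hk
    have h3 : p (ω k) (ω (k + 1)) * ENNReal.ofReal (φ (ω (k + 1))) ≠ 0 := by
      rw [← transitionSum_mul_doob (hfin _)]
      exact mul_ne_zero hk (h2 k)
    have h4 := right_ne_zero_of_mul h3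
    have h5 : ω (k + 1) ≠ x₀ := fun h => h4 (by rw [h, hφ, ENNReal.ofReal_zero])
    exact ⟨h5, by rwa [hψ _ h5]⟩
  have hpos : ∀ k, transitionSum p φ (ω k) ≠ 0 := by
    intro k
    induction k with
    | zero => rwa [h1]
    | succ k ih => exact (hstep k ih).2
  intro k hk
  obtain ⟨m, rfl⟩ := Nat.exists_eq_add_of_le' hk
  exact (hstep m (hpos m)).1

open Classical in
theorem excursion_cyl_inter (hfin : ∀ x, transitionSum p φ x ≠ ∞) (hφ : φ x₀ = 0)
    (hψ : ∀ x, x ≠ x₀ → transitionSum p φ x = ENNReal.ofReal (φ x)) {x : E} {s : ℕ → E} {n : ℕ}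
    (hn : 1 ≤ n) :
    excursion p φ x (cyl n s ∩ avoidFrom x₀ n) = if ∀ j, 1 ≤ j → j ≤ n → s j ≠ x₀ then
      chainLaw p x (cyl n s) * ENNReal.ofReal (φ (s n)) else 0 := by
  have h1 := excursion_avoidFrom hfin hφ hψ x
  split_ifs with hs
  · obtain ⟨m, rfl⟩ := Nat.exists_eq_add_of_le' hn
    rw [← excursion_cyl hfin hψ m fun j hj hj' => hs j hj (by omega)]
    refine measure_congr ?_
    filter_upwards [h1] with ω hω
    exact propext ⟨fun h => h.1, fun h => ⟨h, avoidFrom_mono x₀ hn hω⟩⟩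
  · push Not at hs
    obtain ⟨j, hj, hjn, hs⟩ := hs
    refine measure_mono_null ?_ (ae_iff.1 h1)
    exact fun ω hω h => h j hj ((hω.1 j hjn).trans hs)

theorem excursion_visit (hfin : ∀ x, transitionSum p φ x ≠ ∞)
    (hψ : ∀ x, x ≠ x₀ → transitionSum p φ x = ENNReal.ofReal (φ x)) (x y : E) (n : ℕ) :
    excursion p φ x (visit x₀ (n + 1) y) =
      ENNReal.ofReal (φ y) * chainLaw p x (visit x₀ (n + 1) y) := by
  have key : (excursion p φ x).restrict (visit x₀ (n + 1) y) Set.univ =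
      (ENNReal.ofReal (φ y) • (chainLaw p x).restrict (visit x₀ (n + 1) y)) Set.univ := by
    refine measure_eq_of_cyl (n := n + 1) (fun s => ?_) MeasurableSet.univ
    rw [Measure.smul_apply, Measure.restrict_apply (measurableSet_cyl _ s),
      Measure.restrict_apply (measurableSet_cyl _ s), smul_eq_mul]
    by_cases hs : s (n + 1) = y ∧ ∀ k, 1 ≤ k → k ≤ n + 1 → s k ≠ x₀
    · have h1 : cyl (n + 1) s ∩ visit x₀ (n + 1) y = cyl (n + 1) s :=
        Set.inter_eq_left.2 fun ω hω =>
          ⟨(hω _ le_rfl).trans hs.1, fun k h1 h2 => by rw [hω k h2]; exact hs.2 k h1 h2⟩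
      rw [h1, excursion_cyl hfin hψ n fun j h1 h2 => hs.2 j h1 (by omega), hs.1, mul_comm]
    · have h1 : cyl (n + 1) s ∩ visit x₀ (n + 1) y = ∅ := by
        ext ω
        simp only [Set.mem_inter_iff, Set.mem_empty_iff_false, iff_false, not_and]
        refine fun hω h => hs ⟨(hω _ le_rfl).symm.trans h.1, fun k h1 h2 => ?_⟩
        rw [← hω k h2]; exact h.2 k h1 h2
      simp [h1]
  simpa using key

/-- Borel–Cantelli: the expected number of visits to `y` at positive times is at most `φ y` times a
Green function. -/
theorem excursion_transient (hfin : ∀ x, transitionSum p φ x ≠ ∞) (hφ : φ x₀ = 0)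
    (hψ : ∀ x, x ≠ x₀ → transitionSum p φ x = ENNReal.ofReal (φ x))
    (hgreen : ∀ x y, green p x₀ x y < ∞) (x y : E) :
    ∀ᵐ ω ∂(excursion p φ x), ∃ k, ω ∈ avoidFrom y k := by
  have hsum : ∑' n, excursion p φ x (visit x₀ (n + 1) y) ≠ ∞ := by
    simp_rw [excursion_visit hfin hψ, ENNReal.tsum_mul_left]
    have h := hgreen x y
    rw [green_eq_tsum, tsum_eq_zero_add' ENNReal.summable] at h
    exact (ENNReal.mul_lt_top ENNReal.ofReal_lt_top (ENNReal.add_lt_top.1 h).2).ne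
  filter_upwards [excursion_avoidFrom hfin hφ hψ x, ae_eventually_notMem hsum] with ω h1 h2
  obtain ⟨N, hN⟩ := eventually_atTop.1 h2
  refine ⟨N + 1, fun k hk hky => ?_⟩
  obtain ⟨m, rfl⟩ := Nat.exists_eq_add_of_le' (show 1 ≤ k by omega)
  exact hN m (by omega) ⟨hky, fun j hj _ => h1 j hj⟩

open Classical in
/-- The sum, over the last visit `m` of `x₀`, of the laws of a chain with transitions `p` up to
time `m` followed by an excursion away from `x₀`. -/
noncomputable def lastExit (p : E → PMF E) (x₀ : E) (φ : E → ℝ) (x : E) : Measure (ℕ → E) :=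
  (if x = x₀ then 0 else excursion p φ x) + Measure.sum fun m : ℕ =>
    (((chainLaw p x).restrict {ω | ω m = x₀}).prod (excursion p φ x₀)).map (concat m)

theorem lastExit_start (hfin : ∀ x, transitionSum p φ x ≠ ∞) (x : E) :
    ∀ᵐ ω ∂(lastExit p x₀ φ x), ω 0 = x := by
  have := isFiniteMeasure_excursion hfin x₀
  rw [lastExit, ae_add_measure_iff, Measure.ae_sum_iff]
  refine ⟨?_, fun m => ?_⟩
  · split_ifs
    · simp
    · exact excursion_start x
  · rw [ae_map_iff (measurable_concat m).aemeasurable (measurableSet_eval_eq 0 x)]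
    exact Measure.quasiMeasurePreserving_fst.ae (ae_restrict_of_ae (chainLaw_start p x))

theorem lastExit_transient (hfin : ∀ x, transitionSum p φ x ≠ ∞) (hφ : φ x₀ = 0)
    (hψ : ∀ x, x ≠ x₀ → transitionSum p φ x = ENNReal.ofReal (φ x))
    (hgreen : ∀ x y, green p x₀ x y < ∞) (x y : E) :
    ∀ᵐ ω ∂(lastExit p x₀ φ x), ∃ k, ω ∈ avoidFrom y k := by
  have := isFiniteMeasure_excursion hfin x₀
  have h := excursion_transient hfin hφ hψ hgreen
  rw [lastExit, ae_add_measure_iff, Measure.ae_sum_iff]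
  refine ⟨?_, fun m => ae_map_concat_avoidFrom m y (h x₀ y)⟩
  split_ifs
  · simp
  · exact h x y

open Classical in
-- The term of index `m` consists of trajectories whose last visit to `x₀` is at time `m`, so it
-- sees only cylinders for which `m` is the last visit.
theorem lastExit_term (hfin : ∀ x, transitionSum p φ x ≠ ∞) (hφ : φ x₀ = 0)
    (hψ : ∀ x, x ≠ x₀ → transitionSum p φ x = ENNReal.ofReal (φ x)) (x : E) (s : ℕ → E)
    (n m : ℕ) :
    (((chainLaw p x).restrict {ω | ω m = x₀}).prod (excursion p φ x₀)).map (concat m)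
        (cyl n s ∩ avoidFrom x₀ n) =
      if m < n ∧ s m = x₀ ∧ ∀ j, m < j → j ≤ n → s j ≠ x₀ then
        chainLaw p x (cyl n s) * ENNReal.ofReal (φ (s n)) else 0 := by
  have := isFiniteMeasure_excursion hfin x₀
  have hae : ∀ᵐ ω ∂((((chainLaw p x).restrict {ω | ω m = x₀}).prod (excursion p φ x₀)).map
      (concat m)), ω m = x₀ := by
    rw [ae_map_iff (measurable_concat m).aemeasurable (measurableSet_eval_eq m x₀)]
    filter_upwards [Measure.quasiMeasurePreserving_fst.ae
      (ae_restrict_mem (μ := chainLaw p x) (measurableSet_eval_eq m x₀))] with z hz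
    simpa [concat] using hz
  by_cases hm : m < n
  · by_cases hs : s m = x₀
    · have h0 : ∀ᵐ ω ∂(excursion p φ x₀), ω 0 = s m := by
        rw [hs]; exact excursion_start x₀
      have h1 : cyl m s ∩ {ω : ℕ → E | ω m = x₀} = cyl m s :=
        Set.inter_eq_left.2 fun ω hω => (hω m le_rfl).trans hs
      have hiff : (∀ j, 1 ≤ j → j ≤ n - m → s (m + j) ≠ x₀) ↔ ∀ j, m < j → j ≤ n → s j ≠ x₀ := by
        refine ⟨fun h j h1 h2 => ?_, fun h j h1 h2 => h _ (by omega) (by omega)⟩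
        have := h (j - m) (by omega) (by omega)
        rwa [Nat.add_sub_cancel' h1.le] at this
      rw [concat_cyl _ _ _ _ hm.le h0, Measure.restrict_apply (measurableSet_cyl m s), h1,
        excursion_cyl_inter hfin hφ hψ (by omega), mul_ite, mul_zero, ← mul_assoc]
      simp only [hm, hs, true_and, hiff, Nat.add_sub_cancel' hm.le]
      have h2 := chainLaw_cyl_mul p x s hm.le
      rw [hs] at h2
      rw [h2]
    · rw [if_neg fun h => hs h.2.1]
      refine measure_mono_null ?_ (ae_iff.1 hae)
      exact fun ω hω h => hs ((hω.1 m hm.le).symm.trans h)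
  · rw [if_neg fun h => hm h.1]
    refine measure_mono_null ?_ (ae_iff.1 hae)
    exact fun ω hω => hω.2 m (by omega)

/-- A path ending off `x₀` has exactly one last visit to `x₀` or none, so exactly one term of
`lastExit` contributes, and it contributes the whole right-hand side. -/
theorem lastExit_cyl (hfin : ∀ x, transitionSum p φ x ≠ ∞) (hφ : φ x₀ = 0)
    (hψ : ∀ x, x ≠ x₀ → transitionSum p φ x = ENNReal.ofReal (φ x)) (x : E) (n : ℕ)
    (s : ℕ → E) : lastExit p x₀ φ x (cyl n s ∩ avoidFrom x₀ n) =
      chainLaw p x (cyl n s) * ENNReal.ofReal (φ (s n)) := by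
  classical
  by_cases h0 : s 0 = x
  swap
  · rw [chainLaw_cyl_of_ne _ _ h0, zero_mul]
    refine measure_mono_null ?_ (ae_iff.1 (lastExit_start hfin x))
    exact fun ω hω h => h0 ((hω.1 0 (Nat.zero_le n)).symm.trans h)
  by_cases hn : s n = x₀
  · rw [hn, hφ, ENNReal.ofReal_zero, mul_zero]
    convert measure_empty (μ := lastExit p x₀ φ x)
    ext ω
    simp only [Set.mem_inter_iff, Set.mem_empty_iff_false, iff_false, not_and]
    exact fun h1 h2 => h2 n le_rfl ((h1 n le_rfl).trans hn)
  have hfirst : (if x = x₀ then 0 else excursion p φ x) (cyl n s ∩ avoidFrom x₀ n) =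
      if ∀ j ≤ n, s j ≠ x₀ then chainLaw p x (cyl n s) * ENNReal.ofReal (φ (s n)) else 0 := by
    by_cases hx : x = x₀
    · rw [if_pos hx, if_neg fun h => h 0 (Nat.zero_le n) (h0.trans hx)]
      rfl
    · rw [if_neg hx]
      -- The excursion formula needs `n ≥ 1`; at `n = 0` the event has full measure and the total
      -- mass is `φ x`.
      rcases Nat.eq_zero_or_pos n with rfl | hn0
      · have h1 : ∀ j ≤ 0, s j ≠ x₀ := fun j hj => by
          obtain rfl : j = 0 := by omega
          exact hn
        have h2 : excursion p φ x (cyl 0 s ∩ avoidFrom x₀ 0) = excursion p φ x Set.univ := by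
          refine measure_congr ?_
          filter_upwards [excursion_start x, excursion_avoidFrom hfin hφ hψ x] with ω h3 h4
          refine propext ⟨fun _ => trivial, fun _ => ⟨fun i hi => ?_, fun k _ => ?_⟩⟩
          · obtain rfl : i = 0 := by omega
            exact h3.trans h0.symm
          · rcases Nat.eq_zero_or_pos k with rfl | hk
            · rwa [h3]
            · exact h4 k hk
        rw [if_pos h1, h2, excursion, Measure.smul_apply, measure_univ, ← h0, chainLaw_cyl,
          hψ _ hn]
        simp
      · rw [excursion_cyl_inter hfin hφ hψ hn0]
        refine if_congr ⟨fun h j hj => ?_, fun h j _ hj => h j hj⟩ rfl rfl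
        rcases Nat.eq_zero_or_pos j with rfl | hj0
        · rwa [h0]
        · exact h j hj0 hj
  rw [lastExit, Measure.add_apply, hfirst, Measure.sum_apply _
    ((measurableSet_cyl n s).inter (measurableSet_avoidFrom x₀ n))]
  simp_rw [lastExit_term hfin hφ hψ]
  by_cases hs : ∀ j ≤ n, s j ≠ x₀
  · rw [if_pos hs, ENNReal.tsum_eq_zero.2 fun m => if_neg fun h => hs m h.1.le h.2.1, add_zero]
  · rw [if_neg hs, zero_add]
    push Not at hs
    obtain ⟨j, hj, hjs⟩ := hs
    have hM := Nat.findGreatest_spec (P := fun i => s i = x₀) hj hjs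
    have hM' := Nat.findGreatest_le (P := fun i => s i = x₀) n
    have hM'' := fun i => Nat.findGreatest_is_greatest (P := fun i => s i = x₀) (n := n) (k := i)
    set M := Nat.findGreatest (fun i => s i = x₀) n
    have hMn : M < n := lt_of_le_of_ne hM' fun h => hn (h ▸ hM)
    rw [tsum_eq_single M, if_pos ⟨hMn, hM, hM''⟩]
    intro m hmM
    refine if_neg fun ⟨h1, h2, h3⟩ => ?_
    rcases lt_or_gt_of_ne hmM with h | h
    · exact h3 M h hM' hM
    · exact hM'' m h h1.le h2

theorem exists_isQMeasure (hφ : ∀ x, 0 ≤ φ x) (hφ0 : φ x₀ = 0) (hh : HarmonicOff p x₀ φ)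
    (hfin : ∀ x n, ∫⁻ ω, ENNReal.ofReal (φ (ω n)) ∂(chainLaw p x) < ∞)
    (hgreen : ∀ x y, green p x₀ x y < ∞) (x : E) : ∃ Q, IsQMeasure p x₀ φ x Q := by
  have hψ : ∀ x, x ≠ x₀ → transitionSum p φ x = ENNReal.ofReal (φ x) :=
    fun x hx => transitionSum_eq hφ hh hx
  have hψfin : ∀ x, transitionSum p φ x ≠ ∞ := fun x => by
    have h := hfin x 1
    rw [lintegral_eval_one p x fun y => ENNReal.ofReal (φ y)] at h
    exact h.ne
  have hcyl := lastExit_cyl hψfin hφ0 hψ x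
  have ht := lastExit_transient hψfin hφ0 hψ hgreen x
  have hA : ∀ n, lastExit p x₀ φ x (avoidFrom x₀ n) < ∞ := by
    intro n
    have h := lintegral_avoidFrom_of_cyl (hcyl n) (F := 1) measurable_const
    simp only [Pi.one_apply, one_mul] at h
    have h' := lintegral_indicator_one (μ := lastExit p x₀ φ x) (measurableSet_avoidFrom x₀ n)
    rw [← h']
    exact h.trans_lt (hfin x n)
  have hσ : SigmaFinite (lastExit p x₀ φ x) :=
    -- The null set of recurrent trajectories is added so that the sets cover the whole space.
    ⟨⟨{ set := fun n => avoidFrom x₀ n ∪ {ω | ¬ ∃ k, ω ∈ avoidFrom x₀ k}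
        set_mem := fun _ => trivial
        finite := fun n => by
          refine (measure_union_le _ _).trans_lt ?_
          rw [ae_iff.1 (ht x₀), add_zero]
          exact hA n
        spanning := by
          refine Set.eq_univ_of_forall fun ω => Set.mem_iUnion.2 ?_
          by_cases h : ∃ k, ω ∈ avoidFrom x₀ k
          · exact h.imp fun k hk => Or.inl hk
          · exact ⟨0, Or.inr h⟩ }⟩⟩
  exact ⟨_, IsQMeasure.mk_of_cyl (lastExit_start hψfin x) ht hcyl⟩

theorem isQMeasure_qMeasure {x : E} (h : ∃ Q, IsQMeasure p x₀ φ x Q) :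
    IsQMeasure p x₀ φ x (qMeasure p x₀ φ x) := by
  rw [qMeasure, dif_pos h]
  exact h.choose_spec

end Existence

end RecMartin

namespace RecMartin

/-! ### Harmonic functions of the simple random walk -/

section Harmonic

theorem srw_apply (x y : ℤ) : srw x y = if |y - x| = 1 then 2⁻¹ else 0 := rfl

theorem srw_eq_zero {x y : ℤ} (h : y ∉ ({x + 1, x - 1} : Finset ℤ)) : srw x y = 0 := by
  simp only [Finset.mem_insert, Finset.mem_singleton, not_or] at h
  rw [srw_apply, if_neg]
  intro h'
  rcases (abs_eq zero_le_one).1 h' with h' | h' <;> omega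

theorem srw_add_one (x : ℤ) : srw x (x + 1) = 2⁻¹ := by simp [srw_apply]

theorem srw_sub_one (x : ℤ) : srw x (x - 1) = 2⁻¹ := by simp [srw_apply]

theorem srw_comm (x y : ℤ) : srw x y = srw y x := by
  rw [srw_apply, srw_apply, abs_sub_comm]

theorem tsum_mul_srw (f : ℤ → ℝ≥0∞) (y : ℤ) :
    ∑' z, f z * srw z y = (f (y + 1) + f (y - 1)) * 2⁻¹ := by
  rw [tsum_eq_sum (s := {y + 1, y - 1}) fun z hz => by rw [srw_comm, srw_eq_zero hz, mul_zero],
    Finset.sum_pair (by omega), srw_comm, srw_add_one, srw_comm, srw_sub_one, add_mul]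

theorem hasSum_srw (f : ℤ → ℝ) (x : ℤ) :
    HasSum (fun y => (srw x y).toReal * f y) ((f (x + 1) + f (x - 1)) / 2) := by
  have h : HasSum (fun y => (srw x y).toReal * f y) _ :=
    hasSum_sum_of_ne_finset_zero (s := {x + 1, x - 1}) fun z hz => by rw [srw_eq_zero hz]; simp
  rw [Finset.sum_pair (by omega), srw_add_one, srw_sub_one, ENNReal.toReal_inv] at h
  convert h using 1
  simp
  ring

theorem harmonicOff_srw_iff {f : ℤ → ℝ} :
    HarmonicOff srw 0 f ↔ ∀ x, x ≠ 0 → f x = (f (x + 1) + f (x - 1)) / 2 :=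
  forall₂_congr fun x _ => ⟨fun h => h.unique (hasSum_srw f x), fun h => h ▸ hasSum_srw f x⟩

theorem killedHarmonic_srw_iff {h : ℤ → ℝ} : KilledHarmonic srw 0 h ↔
    ∀ x, h x = ((if x + 1 = 0 then 0 else h (x + 1)) + if x - 1 = 0 then 0 else h (x - 1)) / 2 := by
  refine forall_congr' fun x => ?_
  have h1 := hasSum_srw (fun y => if y = 0 then 0 else h y) x
  have h2 : ∀ {_ : ∀ y : ℤ, Decidable (y ≠ 0)}, (fun y => (srw x y).toReal *
      (if y ≠ 0 then 1 else 0) * h y) = fun y => (srw x y).toReal * if y = 0 then 0 else h y := by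
    intro _
    funext y
    by_cases hy : y = 0 <;> simp [hy]
  exact (iff_of_eq (congrArg (fun f => HasSum f (h x)) h2)).trans
    ⟨fun h => h.unique h1, fun h => by rw [h]; exact h1⟩

theorem eq_nat_mul_of_midpoint {a : ℕ → ℝ} (h0 : a 0 = 0)
    (h : ∀ n, a (n + 1) = (a (n + 2) + a n) / 2) (n : ℕ) : a n = n * a 1 := by
  induction n using Nat.twoStepInduction with
  | zero => simpa using h0
  | one => simp
  | more n h1 h2 =>
    have := h n
    push_cast at h2 ⊢
    linarith

theorem eq_of_harmonicOff_srw {f : ℤ → ℝ} (h0 : f 0 = 0) (h : HarmonicOff srw 0 f) (x : ℤ) :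
    f x = f 1 * max (x : ℝ) 0 + f (-1) * max (-(x : ℝ)) 0 := by
  rw [harmonicOff_srw_iff] at h
  have hp := eq_nat_mul_of_midpoint (a := fun n => f n) h0 fun n => by
    have := h (n + 1) (by omega)
    push_cast
    rw [this]
    ring_nf
  have hn := eq_nat_mul_of_midpoint (a := fun n => f (-n)) (by simpa using h0) fun n => by
    have := h (-(n + 1)) (by omega)
    push_cast
    rw [this, add_comm]
    ring_nf
  obtain ⟨n, rfl | rfl⟩ := x.eq_nat_or_neg
  · have := hp n
    simp at this ⊢
    linarith
  · have := hn n
    simp at this ⊢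
    linarith

theorem harmonicOff_srw_max (a b : ℝ) :
    HarmonicOff srw 0 fun x => a * max (x : ℝ) 0 + b * max (-(x : ℝ)) 0 := by
  rw [harmonicOff_srw_iff]
  intro x hx
  push_cast
  rcases lt_or_gt_of_ne hx with h | h
  · have h' : (x : ℝ) + 1 ≤ 0 := by exact_mod_cast h
    rw [max_eq_right, max_eq_left, max_eq_right, max_eq_left, max_eq_right, max_eq_left] <;> linarith
  · have h' : (1 : ℝ) ≤ x := by exact_mod_cast h
    rw [max_eq_left, max_eq_right, max_eq_left, max_eq_right, max_eq_left, max_eq_right] <;> linarith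

/-- Both slopes `f 1` and `f (-1)` are nonnegative, and boundedness makes them 0. -/
theorem eq_zero_of_harmonicOff_srw {f : ℤ → ℝ} {C : ℝ} (h0 : f 0 = 0) (h : HarmonicOff srw 0 f)
    (hf : ∀ x, 0 ≤ f x) (hC : ∀ x, f x ≤ C) (x : ℤ) : f x = 0 := by
  have key : ∀ c : ℝ, 0 ≤ c → (∀ n : ℕ, c * n ≤ C) → c = 0 := by
    intro c hc h
    by_contra hc0
    obtain ⟨n, hn⟩ := exists_nat_gt (C / c)
    have := h n
    rw [div_lt_iff₀ (lt_of_le_of_ne hc (Ne.symm hc0))] at hn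
    linarith
  have h1 : f 1 = 0 := key _ (hf 1) fun n => by
    have := eq_of_harmonicOff_srw h0 h n
    simp at this
    rw [← this]
    exact hC n
  have h2 : f (-1) = 0 := key _ (hf _) fun n => by
    have := eq_of_harmonicOff_srw h0 h (-n)
    simp at this
    rw [← this]
    exact hC _
  rw [eq_of_harmonicOff_srw h0 h x, h1, h2]
  ring

theorem isStationary_srw : IsStationary srw fun _ => 1 := by
  refine ⟨fun _ => one_pos, fun y => ?_⟩
  simp_rw [srw_comm _ y]
  convert hasSum_srw (fun _ => 1) y using 1
  norm_num

/-- No growth condition is needed: the walk has unit steps, so at time `n` it takes finitely many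
values. -/
theorem lintegral_srw_lt_top (φ : ℤ → ℝ) (x : ℤ) (n : ℕ) :
    ∫⁻ ω, ENNReal.ofReal (φ (ω n)) ∂(chainLaw srw x) < ∞ := by
  have hb : ∀ᵐ ω ∂(chainLaw srw x), ω n ∈ Finset.Icc (x - n) (x + n) := by
    filter_upwards [chainLaw_start srw x, ae_step srw x] with ω h0 h
    induction n with
    | zero => simp [h0]
    | succ n ih =>
      have h1 := h n
      rw [srw_apply] at h1
      have h2 : |ω (n + 1) - ω n| = 1 := by
        by_contra h2
        exact h1 (if_neg h2)
      rw [Finset.mem_Icc] at ih ⊢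
      push_cast
      rcases (abs_eq zero_le_one).1 h2 with h2 | h2 <;> omega
  refine lt_of_le_of_lt (lintegral_mono_ae (g := fun _ =>
    ∑ z ∈ Finset.Icc (x - n) (x + n), ENNReal.ofReal (φ z)) ?_) ?_
  · filter_upwards [hb] with ω hω
    exact Finset.single_le_sum (f := fun z => ENNReal.ofReal (φ z)) (fun _ _ => zero_le) hω
  · rw [lintegral_const, measure_univ, mul_one]
    exact ENNReal.sum_lt_top.2 fun _ _ => ENNReal.ofReal_lt_top

end Harmonic

/-! ### Explicit Green function and Martin kernel -/

section Green

/-- The Green function of the simple random walk with reference point `0`. -/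
def greenVal (x y : ℤ) : ℤ :=
  if x = 0 then 1 else 2 * max 0 (min x y) + 2 * max 0 (min (-x) (-y))

theorem greenVal_nonneg (x y : ℤ) : 0 ≤ greenVal x y := by
  unfold greenVal; split_ifs <;> omega

theorem greenVal_le (x y : ℤ) : greenVal x y ≤ 2 * |x| + 1 := by
  rw [abs_eq_max_neg]; unfold greenVal; split_ifs <;> omega

theorem greenVal_zero_right (x : ℤ) : greenVal x 0 = if 0 = x then 1 else 0 := by
  unfold greenVal; split_ifs <;> omega

/-- For `x ≠ 0`, the kernel rises with slope 2 from 0 to `x` and is then flat, so away from 0 its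
only kink is at `x`, with second difference -2. -/
theorem greenVal_step (x : ℤ) {y : ℤ} (hy : y ≠ 0) :
    2 * greenVal x y = 2 * (if y = x then 1 else 0) + (greenVal x (y + 1) + greenVal x (y - 1)) := by
  unfold greenVal; split_ifs <;> omega

theorem greenVal_of_ne {x : ℤ} (hx : x ≠ 0) (y : ℤ) : (greenVal x y : ℝ) =
    if 0 < x * y then 2 * min |(x : ℝ)| |(y : ℝ)| else 0 := by
  rw [greenVal, if_neg hx]
  rcases lt_or_gt_of_ne hx with h | h
  · rcases lt_or_ge y 0 with h' | h'
    · rw [if_pos (mul_pos_of_neg_of_neg h h')]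
      norm_cast
      simp only [abs_eq_max_neg]
      omega
    · rw [if_neg (not_lt.2 (mul_nonpos_of_nonpos_of_nonneg h.le h'))]
      norm_cast
      omega
  · rcases lt_or_ge 0 y with h' | h'
    · rw [if_pos (mul_pos h h')]
      norm_cast
      simp only [abs_eq_max_neg]
      omega
    · rw [if_neg (not_lt.2 (mul_nonpos_of_nonneg_of_nonpos h.le h'))]
      norm_cast
      omega

/-- Stated for every reference point, since membership in `𝒬` requires finiteness of the Green
function killed at any site. -/
theorem green_srw_le (x₀ x y : ℤ) :
    green srw x₀ x y ≤ ENNReal.ofReal (greenVal (x - x₀) (y - x₀)) := by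
  refine green_le srw x₀ x (fun z => ENNReal.ofReal (greenVal (x - x₀) (z - x₀))) (fun y => ?_) y
  rw [tsum_mul_srw]
  have hn : ∀ u v, (0 : ℝ) ≤ greenVal u v := fun u v => by exact_mod_cast greenVal_nonneg u v
  by_cases hy : y = x₀
  · subst hy
    rw [if_pos rfl, add_zero, sub_self, greenVal_zero_right]
    by_cases h : y = x
    · simp [h]
    · simp [h]
  · have h1 := greenVal_step (x - x₀) (y := y - x₀) (by omega)
    have h2 : (if y - x₀ = x - x₀ then (1 : ℤ) else 0) = if y = x then 1 else 0 := by
      congr 1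
      exact propext ⟨fun h => by omega, fun h => by omega⟩
    rw [h2, show y - x₀ + 1 = y + 1 - x₀ by ring, show y - x₀ - 1 = y - 1 - x₀ by ring] at h1
    have h3 : (greenVal (x - x₀) (y - x₀) : ℝ) = (if y = x then 1 else 0) +
        (greenVal (x - x₀) (y + 1 - x₀) + greenVal (x - x₀) (y - 1 - x₀)) * 2⁻¹ := by
      have h4 : (2 * greenVal (x - x₀) (y - x₀) : ℝ) = 2 * (if y = x then 1 else 0) +
        (greenVal (x - x₀) (y + 1 - x₀) + greenVal (x - x₀) (y - 1 - x₀)) := by exact_mod_cast h1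
      linarith
    rw [if_neg hy, h3, ENNReal.ofReal_add (by split_ifs <;> norm_num)
      (mul_nonneg (add_nonneg (hn _ _) (hn _ _)) (by norm_num)),
      ENNReal.ofReal_mul (add_nonneg (hn _ _) (hn _ _)), ENNReal.ofReal_add (hn _ _) (hn _ _),
      ENNReal.ofReal_inv_of_pos two_pos]
    refine le_of_eq ?_
    split_ifs <;> simp

theorem green_srw_lt_top (x₀ x y : ℤ) : green srw x₀ x y < ∞ :=
  (green_srw_le x₀ x y).trans_lt ENNReal.ofReal_lt_top

theorem green_srw (x y : ℤ) : green srw 0 x y = ENNReal.ofReal (greenVal x y) := by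
  have hle : ∀ y, (green srw 0 x y).toReal ≤ greenVal x y := fun y => by
    have h := green_srw_le 0 x y
    rw [sub_zero, sub_zero] at h
    exact ENNReal.toReal_le_of_le_ofReal (by exact_mod_cast greenVal_nonneg x y) h
  have hrec : ∀ y, (green srw 0 x y).toReal = (if y = x then 1 else 0) + if y = 0 then 0 else
      ((green srw 0 x (y + 1)).toReal + (green srw 0 x (y - 1)).toReal) / 2 := by
    intro y
    have h1 := green_srw_lt_top 0 x (y + 1)
    have h2 := green_srw_lt_top 0 x (y - 1)
    rw [green_recursion, tsum_mul_srw, ENNReal.toReal_add (by split_ifs <;> simp)]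
    · congr 1
      · split_ifs <;> simp
      · split_ifs
        · simp
        · rw [ENNReal.toReal_mul, ENNReal.toReal_add h1.ne h2.ne]
          simp [div_eq_mul_inv]
    · split_ifs
      · simp
      · exact ENNReal.mul_ne_top (ENNReal.add_lt_top.2 ⟨h1, h2⟩).ne (by simp)
  -- In the variable `y` the source terms at `x` cancel, leaving a bounded function harmonic off 0.
  have hd := eq_zero_of_harmonicOff_srw (f := fun y => greenVal x y - (green srw 0 x y).toReal)
    (C := 2 * |x| + 1) ?_ ?_ ?_ ?_ y
  · rw [sub_eq_zero.1 hd, ENNReal.ofReal_toReal (green_srw_lt_top 0 x y).ne]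
  · rw [hrec, greenVal_zero_right]
    simp
  · rw [harmonicOff_srw_iff]
    intro y hy
    have h1 : (2 * greenVal x y : ℝ) = 2 * (if y = x then 1 else 0) +
        (greenVal x (y + 1) + greenVal x (y - 1)) := by exact_mod_cast greenVal_step x hy
    have h2 := hrec y
    rw [if_neg hy] at h2
    linarith
  · exact fun y => sub_nonneg.2 (hle y)
  · intro y
    have h1 : (greenVal x y : ℝ) ≤ 2 * |x| + 1 := by exact_mod_cast greenVal_le x y
    have h2 : 0 ≤ (green srw 0 x y).toReal := ENNReal.toReal_nonneg
    linarith

theorem green_srw_zero (y : ℤ) : green srw 0 0 y = 1 := by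
  simp [green_srw, greenVal]

theorem martinL_srw (x y : ℤ) : martinL srw 0 x y = greenVal x y := by
  rw [martinL, green_srw_zero, div_one, green_srw, ENNReal.toReal_ofReal]
  exact_mod_cast greenVal_nonneg x y

theorem martinL_srw_eq_of_le {z y : ℤ} (h : |z| < y) :
    martinL srw 0 z y = 2 * max (z : ℝ) 0 + if z = 0 then 1 else 0 := by
  rw [martinL_srw]
  norm_cast
  rw [abs_eq_max_neg] at h
  unfold greenVal
  split_ifs <;> omega

theorem martinL_srw_eq_of_le_neg {z y : ℤ} (h : |z| < -y) :
    martinL srw 0 z y = 2 * max (-(z : ℝ)) 0 + if z = 0 then 1 else 0 := by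
  rw [martinL_srw]
  norm_cast
  rw [abs_eq_max_neg] at h
  unfold greenVal
  split_ifs <;> omega

theorem martinD_srw_lt_top (z : ℤ) : martinD srw 0 z < ∞ := by
  refine lt_of_le_of_lt (iSup_le fun y => ?_) (ENNReal.ofReal_lt_top (r := 2 * |z| + 1))
  rw [martinL_srw]
  exact ENNReal.ofReal_le_ofReal (by exact_mod_cast greenVal_le z y)

end Green

end RecMartin

namespace RecMartin

/-! ### Convergence in the Martin compactification -/

section MartinTopology

variable {E : Type*} [Countable E] [MeasurableSpace E] [MeasurableSingletonClass E]
  {p : E → PMF E} {x₀ : E} {w : E → ℝ≥0}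

theorem edist_martinL_le (p : E → PMF E) (x₀ z x y : E) :
    edist (martinL p x₀ z x) (martinL p x₀ z y) ≤ martinD p x₀ z := by
  have h : ∀ u v, 0 ≤ u → 0 ≤ v → edist u v ≤ max (ENNReal.ofReal u) (ENNReal.ofReal v) := by
    intro u v hu hv
    rw [edist_dist, Real.dist_eq, ← ENNReal.ofReal_max]
    refine ENNReal.ofReal_le_ofReal (abs_sub_le_iff.2 ⟨?_, ?_⟩)
    · linarith [le_max_left u v]
    · linarith [le_max_right u v]
  exact (h _ _ ENNReal.toReal_nonneg ENNReal.toReal_nonneg).trans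
    (max_le (le_iSup (fun y => ENNReal.ofReal (martinL p x₀ z y)) x)
      (le_iSup (fun y => ENNReal.ofReal (martinL p x₀ z y)) y))

omit [Countable E] [MeasurableSpace E] [MeasurableSingletonClass E] in
theorem edist_indicator_le (z x y : E) :
    edist (({x} : Set E).indicator (1 : E → ℝ) z) (({y} : Set E).indicator (1 : E → ℝ) z) ≤ 1 := by
  classical
  rw [Set.indicator_apply, Set.indicator_apply, edist_dist]
  split_ifs <;> simp

theorem martinDist_term_le (p : E → PMF E) (x₀ : E) (w : E → ℝ≥0) (x y z : E) :
    (w z : ℝ≥0∞) * ((edist (martinL p x₀ z x) (martinL p x₀ z y) +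
      edist (({x} : Set E).indicator (1 : E → ℝ) z) (({y} : Set E).indicator (1 : E → ℝ) z)) /
        (martinD p x₀ z + 1)) ≤ w z :=
  mul_le_of_le_one_right' <| ENNReal.div_le_of_le_mul <| by
    rw [one_mul]
    exact add_le_add (edist_martinL_le p x₀ z x y) (edist_indicator_le z x y)

/-- Each summand of the distance is at most `w z`, so the tail is small uniformly; along `F`, the
finitely many remaining summands are eventually 0. The condition `y ≠ z` removes the indicators. -/
theorem exists_tendsto_toMartin (hw : Summable w) {F : Filter E} [NeBot F] {l : E → ℝ}
    (hF : ∀ z, ∀ᶠ y in F, martinL p x₀ z y = l z ∧ y ≠ z) :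
    ∃ α, Tendsto (toMartin p x₀ w) F (𝓝 α) := by
  have hc : @Cauchy (MartinBase p x₀ w) _ F := by
    refine EMetric.cauchy_iff.2 ⟨NeBot.ne ‹_›, fun ε hε => ?_⟩
    have hsum : ∑' z, (w z : ℝ≥0∞) ≠ ∞ := ENNReal.tsum_coe_ne_top_iff_summable.2 hw
    obtain ⟨s, hs⟩ := ((ENNReal.tendsto_tsum_compl_atTop_zero hsum).eventually (gt_mem_nhds hε)).exists
    have hs' := (eventually_all_finset s).2 fun z _ => hF z
    refine ⟨_, hs', fun (x : E) hx (y : E) hy => lt_of_le_of_lt ?_ hs⟩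
    change martinDist p x₀ w x y ≤ _
    unfold martinDist
    rw [← tsum_subtype_eq_of_support_subset (s := {z | z ∉ s})]
    · exact ENNReal.tsum_le_tsum fun z => martinDist_term_le p x₀ w x y z
    · intro z hz hzs
      refine hz ?_
      have h1 := hx z hzs
      have h2 := hy z hzs
      have h3 : ({x} : Set E).indicator (1 : E → ℝ) z = 0 :=
        Set.indicator_of_notMem (fun h => h1.2 h.symm) _
      have h4 : ({y} : Set E).indicator (1 : E → ℝ) z = 0 :=
        Set.indicator_of_notMem (fun h => h2.2 h.symm) _
      beta_reduce
      rw [h1.1, h2.1, h3, h4]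
      simp
  exact CompleteSpace.complete (hc.map (UniformSpace.Completion.uniformContinuous_coe _))

theorem le_martinDist (p : E → PMF E) (x₀ : E) (w : E → ℝ≥0) (x y z : E) :
    (w z : ℝ≥0∞) * ((edist (martinL p x₀ z x) (martinL p x₀ z y) +
      edist (({x} : Set E).indicator (1 : E → ℝ) z) (({y} : Set E).indicator (1 : E → ℝ) z)) /
        (martinD p x₀ z + 1)) ≤ martinDist p x₀ w x y :=
  ENNReal.le_tsum (f := fun z => (w z : ℝ≥0∞) * ((edist (martinL p x₀ z x) (martinL p x₀ z y) +
      edist (({x} : Set E).indicator (1 : E → ℝ) z) (({y} : Set E).indicator (1 : E → ℝ) z)) /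
        (martinD p x₀ z + 1))) z

/-- The indicator summand at `z = x` keeps every other point at a fixed positive distance from `x`.
-/
theorem not_tendsto_toMartin (hw : ∀ z, 0 < w z) (hD : ∀ z, martinD p x₀ z < ∞) {F : Filter E}
    [NeBot F] (hF : ∀ z, ∀ᶠ y in F, y ≠ z) (x : E) :
    ¬ Tendsto (toMartin p x₀ w) F (𝓝 (toMartin p x₀ w x)) := by
  intro h
  have hi := (UniformSpace.Completion.isUniformInducing_coe (MartinBase p x₀ w)).isInducing
  have h1 : Tendsto (β := MartinBase p x₀ w) (fun y => y) F (@nhds (MartinBase p x₀ w) _ x) :=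
    hi.tendsto_nhds_iff.2 h
  have hc : (0 : ℝ≥0∞) < w x * (1 / (martinD p x₀ x + 1)) :=
    ENNReal.mul_pos (ENNReal.coe_pos.2 (hw x)).ne'
      (ENNReal.div_pos one_ne_zero (ENNReal.add_lt_top.2 ⟨hD x, ENNReal.one_lt_top⟩).ne).ne'
  have h2 : ∀ᶠ y in F, martinDist p x₀ w y x < w x * (1 / (martinD p x₀ x + 1)) :=
    h1 (Metric.eball_mem_nhds (α := MartinBase p x₀ w) x hc)
  obtain ⟨y, hy, hyx⟩ := (h2.and (hF x)).exists
  refine (lt_self_iff_false _).1 (lt_of_le_of_lt (le_trans ?_ (le_martinDist p x₀ w y x x)) hy)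
  gcongr
  simp [hyx.symm, edist_dist]

/-- The single summand of index `z` gives the Lipschitz constant `(D(z) + 1) / w z`. -/
theorem uniformContinuous_martinL (hw : ∀ z, 0 < w z) (hD : ∀ z, martinD p x₀ z < ∞) (z : E) :
    UniformContinuous fun y : MartinBase p x₀ w => martinL p x₀ z y := by
  have hD1 : martinD p x₀ z + 1 ≠ ∞ := (ENNReal.add_lt_top.2 ⟨hD z, ENNReal.one_lt_top⟩).ne
  have hw0 : (w z : ℝ≥0∞) ≠ 0 := (ENNReal.coe_pos.2 (hw z)).ne'
  have hK : (martinD p x₀ z + 1) / w z ≠ ∞ := ENNReal.div_ne_top hD1 hw0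
  refine LipschitzWith.uniformContinuous (K := ((martinD p x₀ z + 1) / w z).toNNReal) fun x y => ?_
  rw [ENNReal.coe_toNNReal hK]
  have h := le_martinDist p x₀ w x y z
  change _ ≤ _ * martinDist p x₀ w x y
  refine le_trans ?_ (mul_le_mul_right h _)
  rw [← mul_assoc, ENNReal.div_mul_cancel hw0 ENNReal.coe_ne_top,
    ENNReal.mul_div_cancel (by simp) hD1]
  exact le_self_add

theorem martinLExt_eq_of_tendsto (hw : ∀ z, 0 < w z) (hD : ∀ z, martinD p x₀ z < ∞)
    {F : Filter E} [NeBot F] {α : MartinCompactification p x₀ w}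
    (hα : Tendsto (toMartin p x₀ w) F (𝓝 α)) {z : E} {l : ℝ}
    (hF : ∀ᶠ y in F, martinL p x₀ z y = l) : martinLExt p x₀ w z α = l := by
  have hc : Continuous (martinLExt p x₀ w z) := UniformSpace.Completion.continuous_extension
  have h1 := (hc.tendsto α).comp hα
  refine tendsto_nhds_unique h1 (tendsto_const_nhds.congr' ?_)
  filter_upwards [hF] with y hy
  rw [← hy]
  exact (UniformSpace.Completion.extension_coe (uniformContinuous_martinL hw hD z)
    (y : MartinBase p x₀ w)).symm

end MartinTopology

/-! ### The two boundary points and their minimality -/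

section MartinSrw

variable {w : ℤ → ℝ≥0}

/-- The killed transitions never read the value at 0: reset to 0 there, `ψ` is harmonic off 0, and
its actual value at 0 is half the sum of its neighbours. -/
theorem killedHarmonic_srw_eq {ψ : ℤ → ℝ} : KilledHarmonic srw 0 ψ ↔ ∀ x, ψ x =
    ψ 1 * max (x : ℝ) 0 + ψ (-1) * max (-(x : ℝ)) 0 +
      if x = 0 then (ψ 1 + ψ (-1)) / 2 else 0 := by
  rw [killedHarmonic_srw_iff]
  constructor
  · intro h x
    have h1 := eq_of_harmonicOff_srw (f := fun x => if x = 0 then 0 else ψ x) (by simp)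
      (harmonicOff_srw_iff.2 fun x hx => by rw [if_neg hx]; exact h x) x
    by_cases hx : x = 0
    · have := h 0
      simp at this
      simp [hx, this]
    · simpa [hx] using h1
  · intro h x
    have h1 := harmonicOff_srw_iff.1 (harmonicOff_srw_max (ψ 1) (ψ (-1))) x
    by_cases hx : x = 0
    · rw [h x]
      simp [hx]
    · have h2 : ∀ y : ℤ, (if y = 0 then 0 else ψ y) =
          ψ 1 * max (y : ℝ) 0 + ψ (-1) * max (-(y : ℝ)) 0 := fun y => by
        by_cases hy : y = 0
        · simp [hy]
        · rw [if_neg hy, h y, if_neg hy, add_zero]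
      rw [h2, h2, ← h1 hx, h x, if_neg hx, add_zero]

theorem isMinimalHarmonic_srw_pos :
    IsMinimalHarmonic srw 0 fun x : ℤ => 2 * max (x : ℝ) 0 + if x = 0 then 1 else 0 := by
  refine ⟨killedHarmonic_srw_eq.2 fun x => by simp, fun ψ hψ hle => ?_⟩
  have h1 := hle 1
  have h2 := hle (-1)
  norm_num at h1 h2
  have h3 : ψ (-1) = 0 := le_antisymm h2.2 h2.1
  -- The bound at -1 removes the negative half-line; the dominating function is 2 at 1, whence the
  -- ratio.
  refine ⟨ψ 1 / 2, ⟨by linarith, by linarith⟩, fun x => ?_⟩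
  rw [killedHarmonic_srw_eq.1 hψ x, h3]
  by_cases hx : x = 0
  · simp [hx]
  · simp only [hx, if_false]
    ring

theorem isMinimalHarmonic_srw_neg :
    IsMinimalHarmonic srw 0 fun x : ℤ => 2 * max (-(x : ℝ)) 0 + if x = 0 then 1 else 0 := by
  refine ⟨killedHarmonic_srw_eq.2 fun x => by simp, fun ψ hψ hle => ?_⟩
  have h1 := hle 1
  have h2 := hle (-1)
  norm_num at h1 h2
  have h3 : ψ 1 = 0 := le_antisymm h1.2 h1.1
  refine ⟨ψ (-1) / 2, ⟨by linarith, by linarith⟩, fun x => ?_⟩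
  rw [killedHarmonic_srw_eq.1 hψ x, h3]
  by_cases hx : x = 0
  · simp [hx]
  · simp only [hx, if_false]
    ring

theorem eventually_atTop_martinL_srw (z : ℤ) : ∀ᶠ y in atTop,
    martinL srw 0 z y = (2 * max (z : ℝ) 0 + if z = 0 then 1 else 0) ∧ y ≠ z := by
  filter_upwards [eventually_gt_atTop |z|] with y hy
  exact ⟨martinL_srw_eq_of_le hy, ((le_abs_self z).trans_lt hy).ne'⟩

theorem eventually_atBot_martinL_srw (z : ℤ) : ∀ᶠ y in atBot,
    martinL srw 0 z y = (2 * max (-(z : ℝ)) 0 + if z = 0 then 1 else 0) ∧ y ≠ z := by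
  filter_upwards [eventually_lt_atBot (-|z|)] with y hy
  exact ⟨martinL_srw_eq_of_le_neg (by omega), (hy.trans_le (neg_abs_le z)).ne⟩

theorem ultrafilter_int (U : Ultrafilter ℤ) :
    (∃ x, U = pure x) ∨ (U : Filter ℤ) ≤ atTop ∨ (U : Filter ℤ) ≤ atBot := by
  rcases U.le_cofinite_or_eq_pure with h | h
  · rw [Int.cofinite_eq, Ultrafilter.le_sup_iff] at h
    exact Or.inr h.symm
  · exact Or.inl h

/-- The Martin boundary consists of the limits of `toMartin` at `±∞`. -/
theorem martinBoundary_eq {a b : MartinCompactification srw 0 w}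
    (hw : ∀ z, 0 < w z) (ha : Tendsto (toMartin srw 0 w) atTop (𝓝 a))
    (hb : Tendsto (toMartin srw 0 w) atBot (𝓝 b)) : martinBoundary srw 0 w = {a, b} := by
  refine Set.Subset.antisymm (fun α hα => ?_) ?_
  · have hne : NeBot (comap (toMartin srw 0 w) (𝓝 α)) :=
      (UniformSpace.Completion.isDenseInducing_coe (α := MartinBase srw 0 w)).comap_nhds_neBot α
    -- By density, every point of the compactification is a limit along some ultrafilter on the
    -- integers.
    obtain ⟨U, hU⟩ := Ultrafilter.exists_le (comap (toMartin srw 0 w) (𝓝 α))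
    have ht : Tendsto (toMartin srw 0 w) U (𝓝 α) := tendsto_iff_comap.2 hU
    rcases ultrafilter_int U with ⟨x, rfl⟩ | h | h
    · refine absurd ⟨x, ?_⟩ hα
      exact (tendsto_nhds_unique ht (tendsto_pure_nhds _ _)).symm
    · exact Or.inl (tendsto_nhds_unique ht (ha.mono_left h))
    · exact Or.inr (tendsto_nhds_unique ht (hb.mono_left h))
  · rintro α (rfl | rfl) ⟨x, rfl⟩
    · exact not_tendsto_toMartin hw martinD_srw_lt_top
        (fun z => (eventually_atTop_martinL_srw z).mono fun _ h => h.2) x ha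
    · exact not_tendsto_toMartin hw martinD_srw_lt_top
        (fun z => (eventually_atBot_martinL_srw z).mono fun _ h => h.2) x hb

/-- Convergence is tested on ultrafilters: a principal image would give a limit inside the integers,
and an image finer than `B` would give the limit `b`. The two ends are kept abstract so that they
can be swapped. -/
theorem tendsto_toMartin_iff {a b : MartinCompactification srw 0 w} {A B : Filter ℤ} (hab : a ≠ b)
    (ha : Tendsto (toMartin srw 0 w) A (𝓝 a)) (hb : Tendsto (toMartin srw 0 w) B (𝓝 b))
    (hU : ∀ U : Ultrafilter ℤ, (∃ x, U = pure x) ∨ (U : Filter ℤ) ≤ A ∨ (U : Filter ℤ) ≤ B)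
    (hmem : a ∈ martinBoundary srw 0 w) (u : ℕ → ℤ) :
    Tendsto (fun n => toMartin srw 0 w (u n)) atTop (𝓝 a) ↔ Tendsto u atTop A := by
  refine ⟨fun h => ?_, fun h => ha.comp h⟩
  rw [tendsto_iff_ultrafilter]
  intro V hV
  have ht : Tendsto (toMartin srw 0 w) (V.map u) (𝓝 a) := by
    rw [Ultrafilter.coe_map, tendsto_map'_iff]
    exact h.mono_left hV
  rcases hU (V.map u) with ⟨x, hx⟩ | h' | h'
  · rw [hx] at ht
    exact absurd ⟨x, (tendsto_nhds_unique ht (tendsto_pure_nhds _ _)).symm⟩ hmem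
  · exact h'
  · exact absurd (tendsto_nhds_unique ht (hb.mono_left h')) hab

end MartinSrw

/-! ### The class `𝒬` of the simple random walk -/

section ClassSrw

theorem existsUnique_isQMeasure_srw {φ : ℤ → ℝ} (hφ : ∀ x, 0 ≤ φ x) (h0 : φ 0 = 0)
    (hh : HarmonicOff srw 0 φ) (x : ℤ) (Q : Measure (ℕ → ℤ)) :
    IsQMeasure srw 0 φ x Q ↔ Q = qMeasure srw 0 φ x := by
  have h := isQMeasure_qMeasure
    (exists_isQMeasure hφ h0 hh (lintegral_srw_lt_top φ) (green_srw_lt_top 0) x)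
  exact ⟨fun hQ => hQ.unique (lintegral_srw_lt_top φ x) h, fun hQ => hQ ▸ h⟩

/-- The cylinder formula is linear in `φ` for nonnegative coefficients and functions. -/
theorem IsQMeasure.add_smul {E : Type*} [Countable E] [MeasurableSpace E]
    [MeasurableSingletonClass E] {p : E → PMF E} {x₀ x : E} {φ₁ φ₂ φ : E → ℝ}
    {Q₁ Q₂ : Measure (ℕ → E)} (h₁ : IsQMeasure p x₀ φ₁ x Q₁) (h₂ : IsQMeasure p x₀ φ₂ x Q₂)
    (hφ₁ : ∀ y, 0 ≤ φ₁ y) (hφ₂ : ∀ y, 0 ≤ φ₂ y) (a b : ℝ≥0)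
    (hφ : ∀ y, φ y = a * φ₁ y + b * φ₂ y) : IsQMeasure p x₀ φ x (a • Q₁ + b • Q₂) := by
  have := h₁.sigmaFinite
  have := h₂.sigmaFinite
  refine IsQMeasure.mk_of_cyl ?_ (fun y => ?_) fun n s => ?_
  · exact ae_add_measure_iff.2
      ⟨Measure.ae_smul_measure h₁.ae_start a, Measure.ae_smul_measure h₂.ae_start b⟩
  · exact ae_add_measure_iff.2 ⟨Measure.ae_smul_measure (h₁.ae_avoidFrom y) a,
      Measure.ae_smul_measure (h₂.ae_avoidFrom y) b⟩
  · rw [Measure.add_apply, Measure.smul_apply, Measure.smul_apply, h₁.cyl, h₂.cyl, hφ,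
      ENNReal.ofReal_add (mul_nonneg a.coe_nonneg (hφ₁ _)) (mul_nonneg b.coe_nonneg (hφ₂ _)),
      ENNReal.ofReal_mul a.coe_nonneg, ENNReal.ofReal_mul b.coe_nonneg, ENNReal.smul_def, ENNReal.smul_def,
      smul_eq_mul, smul_eq_mul, ENNReal.ofReal_coe_nnreal, ENNReal.ofReal_coe_nnreal]
    ring

theorem classQ_srw_iff {φ₁ φ₂ : ℤ → ℝ} (h₁ : ∀ x : ℤ, φ₁ x = 2 * max (x : ℝ) 0)
    (h₂ : ∀ x : ℤ, φ₂ x = 2 * max (-(x : ℝ)) 0) (Q : ℤ → Measure (ℕ → ℤ)) :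
    ClassQ srw Q ↔ ∃ a b : ℝ≥0, ∀ x, Q x = a • qMeasure srw 0 φ₁ x + b • qMeasure srw 0 φ₂ x := by
  have hn₁ : ∀ x, 0 ≤ φ₁ x := fun x => by rw [h₁]; positivity
  have hn₂ : ∀ x, 0 ≤ φ₂ x := fun x => by rw [h₂]; positivity
  have hh₁ : HarmonicOff srw 0 φ₁ := by
    have := harmonicOff_srw_max 2 0
    simp only [zero_mul, add_zero] at this
    rwa [funext h₁]
  have hh₂ : HarmonicOff srw 0 φ₂ := by
    have := harmonicOff_srw_max 0 2
    simp only [zero_mul, zero_add] at this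
    rwa [funext h₂]
  have hQ₁ := fun x => (existsUnique_isQMeasure_srw hn₁ (by simp [h₁]) hh₁ x _).2 rfl
  have hQ₂ := fun x => (existsUnique_isQMeasure_srw hn₂ (by simp [h₂]) hh₂ x _).2 rfl
  have hadd : ∀ (a b : ℝ≥0) x, IsQMeasure srw 0 (fun y => a * φ₁ y + b * φ₂ y) x
      (a • qMeasure srw 0 φ₁ x + b • qMeasure srw 0 φ₂ x) := fun a b x =>
    (hQ₁ x).add_smul (hQ₂ x) hn₁ hn₂ a b fun _ => rfl
  constructor
  · intro hQ
    let φ : ℤ → ℝ := fun y => (Q y (avoidFrom 0 0)).toReal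
    have hpos : ∀ y, 0 ≤ φ y := fun y => ENNReal.toReal_nonneg
    have hnn : ∀ c : ℝ, 0 ≤ c → ∃ a : ℝ≥0, (a : ℝ) = c := fun c hc =>
      ⟨c.toNNReal, Real.coe_toNNReal c hc⟩
    -- The extremal functions take the value 2 at 1 and at -1 respectively, hence the halves.
    obtain ⟨a, ha⟩ := hnn (φ 1 / 2) (by have := hpos 1; positivity)
    obtain ⟨b, hb⟩ := hnn (φ (-1) / 2) (by have := hpos (-1); positivity)
    refine ⟨a, b, fun x => ?_⟩
    have heq : (fun y => a * φ₁ y + b * φ₂ y) = φ := by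
      funext y
      have h := eq_of_harmonicOff_srw (f := φ) (hQ.toReal_avoidFrom_self 0) (hQ.harmonicOff 0) y
      rw [h, ha, hb, h₁, h₂]
      ring
    exact (hQ.isQMeasure 0 x).unique (lintegral_srw_lt_top φ x) (heq ▸ hadd a b x)
  · rintro ⟨a, b, hQ⟩
    rw [funext hQ]
    exact IsQMeasure.classQ (hadd a b) (lintegral_srw_lt_top fun y => a * φ₁ y + b * φ₂ y)
      fun x₁ x _ => green_srw_lt_top x₁ x 0

end ClassSrw

end RecMartin

open RecMartin MeasureTheory Filter Topology in
theorem mainTheorem10 (w : ℤ → NNReal) (hw_pos : ∀ z, 0 < w z) (hw_sum : Summable w) :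
    -- the Green function and the Martin kernel with reference point `0`
    (∀ y : ℤ, green srw 0 0 y = 1) ∧
    (∀ x y : ℤ, x ≠ 0 →
      green srw 0 x y = ENNReal.ofReal (if 0 < x * y then 2 * min |(x : ℝ)| |(y : ℝ)| else 0)) ∧
    (∀ y : ℤ, martinL srw 0 0 y = 1) ∧
    (∀ x y : ℤ, x ≠ 0 →
      martinL srw 0 x y = if 0 < x * y then 2 * min |(x : ℝ)| |(y : ℝ)| else 0) ∧
    -- the normalization of the stationary measure
    IsStationary srw (fun _ => 1) ∧
    -- the points `pinf = ∞` and `ninf = -∞`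
    ∃ pinf ninf : MartinCompactification srw 0 w,
      pinf ≠ ninf ∧
      martinBoundary srw 0 w = {pinf, ninf} ∧
      minimalBoundary srw 0 w = martinBoundary srw 0 w ∧
      (∀ x : ℤ, martinLExt srw 0 w x pinf = 2 * max (x : ℝ) 0 + if x = 0 then 1 else 0) ∧
      (∀ x : ℤ, martinLExt srw 0 w x ninf = 2 * max (-(x : ℝ)) 0 + if x = 0 then 1 else 0) ∧
      (∀ u : ℕ → ℤ,
        Tendsto (fun n => toMartin srw 0 w (u n)) atTop (𝓝 pinf) ↔ Tendsto u atTop atTop) ∧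
      (∀ u : ℕ → ℤ,
        Tendsto (fun n => toMartin srw 0 w (u n)) atTop (𝓝 ninf) ↔ Tendsto u atTop atBot) ∧
      (∀ x : ℤ, martinPhi srw (fun _ => 1) 0 w pinf x = 2 * max (x : ℝ) 0) ∧
      (∀ x : ℤ, martinPhi srw (fun _ => 1) 0 w ninf x = 2 * max (-(x : ℝ)) 0) ∧
      -- the nonnegative functions vanishing at `0` and harmonic elsewhere
      (∀ φ : ℤ → ℝ, ((∀ x, 0 ≤ φ x) ∧ φ 0 = 0 ∧ HarmonicOff srw 0 φ) ↔
        ∃ a b : ℝ, 0 ≤ a ∧ 0 ≤ b ∧ ∀ x, φ x =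
          a * martinPhi srw (fun _ => 1) 0 w pinf x + b * martinPhi srw (fun _ => 1) 0 w ninf x) ∧
      -- `ℚ_x^{±∞}` are well defined
      (∀ α ∈ minimalBoundary srw 0 w, ∀ (x : ℤ) (Q : Measure (ℕ → ℤ)),
        IsQMeasure srw 0 (martinPhi srw (fun _ => 1) 0 w α) x Q ↔
          Q = martinQ srw (fun _ => 1) 0 w α x) ∧
      -- the class `𝒬`
      (∀ Q : ℤ → Measure (ℕ → ℤ), ClassQ srw Q ↔
        ∃ a b : NNReal, ∀ x, Q x =
          a • martinQ srw (fun _ => 1) 0 w pinf x + b • martinQ srw (fun _ => 1) 0 w ninf x) := by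

  have hD := martinD_srw_lt_top
  obtain ⟨a, ha⟩ := exists_tendsto_toMartin hw_sum eventually_atTop_martinL_srw
  obtain ⟨b, hb⟩ := exists_tendsto_toMartin hw_sum eventually_atBot_martinL_srw
  have hLa : ∀ x : ℤ, martinLExt srw 0 w x a = 2 * max (x : ℝ) 0 + if x = 0 then 1 else 0 :=
    fun x => martinLExt_eq_of_tendsto hw_pos hD ha
      ((eventually_atTop_martinL_srw x).mono fun _ h => h.1)
  have hLb : ∀ x : ℤ, martinLExt srw 0 w x b = 2 * max (-(x : ℝ)) 0 + if x = 0 then 1 else 0 :=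
    fun x => martinLExt_eq_of_tendsto hw_pos hD hb
      ((eventually_atBot_martinL_srw x).mono fun _ h => h.1)
  have hab : a ≠ b := by
    intro h
    have h1 := hLa 1
    have h2 := hLb 1
    rw [h, h2] at h1
    norm_num at h1
  have hbdry := martinBoundary_eq hw_pos ha hb
  have hmin : minimalBoundary srw 0 w = martinBoundary srw 0 w := by
    refine Set.Subset.antisymm (fun α hα => hα.1) fun α hα => ⟨hα, ?_⟩
    rw [hbdry] at hα
    rcases hα with rfl | rfl
    · rw [funext hLa]
      exact isMinimalHarmonic_srw_pos
    · rw [funext hLb]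
      exact isMinimalHarmonic_srw_neg
  have hφa : ∀ x : ℤ, martinPhi srw (fun _ => 1) 0 w a x = 2 * max (x : ℝ) 0 := fun x => by
    rw [martinPhi, hLa]
    by_cases hx : x = 0 <;> simp [hx]
  have hφb : ∀ x : ℤ, martinPhi srw (fun _ => 1) 0 w b x = 2 * max (-(x : ℝ)) 0 := fun x => by
    rw [martinPhi, hLb]
    by_cases hx : x = 0 <;> simp [hx]
  have hharm : ∀ c d : ℝ, HarmonicOff srw 0 fun x => c * martinPhi srw (fun _ => 1) 0 w a x +
      d * martinPhi srw (fun _ => 1) 0 w b x := fun c d => by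
    simp_rw [hφa, hφb, ← mul_assoc]
    exact harmonicOff_srw_max (c * 2) (d * 2)
  refine ⟨green_srw_zero, fun x y hx => ?_, fun y => ?_, fun x y hx => ?_, isStationary_srw,
    a, b, hab, hbdry, hmin, hLa, hLb,
    tendsto_toMartin_iff hab ha hb ultrafilter_int (by simp [hbdry]),
    tendsto_toMartin_iff hab.symm hb ha (fun U => (ultrafilter_int U).imp_right Or.symm)
      (by simp [hbdry]), hφa, hφb, fun φ => ⟨fun ⟨hn, h0, hh⟩ => ?_, ?_⟩, fun α hα x Q => ?_,
    classQ_srw_iff hφa hφb⟩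
  · rw [green_srw, greenVal_of_ne hx]
  · rw [martinL_srw]
    simp [greenVal]
  · rw [martinL_srw, greenVal_of_ne hx]
  · refine ⟨φ 1 / 2, φ (-1) / 2, by have := hn 1; positivity, by have := hn (-1); positivity,
      fun x => ?_⟩
    rw [eq_of_harmonicOff_srw h0 hh x, hφa, hφb]
    ring
  · rintro ⟨c, d, hc, hd, hφ⟩
    refine ⟨fun x => ?_, ?_, ?_⟩
    · rw [hφ, hφa, hφb]
      positivity
    · rw [hφ, hφa, hφb]
      simp
    · rw [funext hφ]
      exact hharm c d
  · rw [hmin, hbdry] at hα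
    rcases hα with rfl | rfl
    · refine existsUnique_isQMeasure_srw (fun x => ?_) ?_ ?_ x Q
      · rw [hφa]
        positivity
      · simp [hφa]
      · simpa using hharm 1 0
    · refine existsUnique_isQMeasure_srw (fun x => ?_) ?_ ?_ x Q
      · rw [hφb]
        positivity
      · simp [hφb]
      · simpa using hharm 0 1
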